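/- Let $\mathbb D$ be the open unit disk, and let $A,B\in\mathbb C$ with $|B|\le 1$ and $A\neq B$. Put $P(z)=\frac{1+Az}{1+Bz}$. Let $\mathcal{CV}(A,B)$ be the class of functions $f$ analytic in $\mathbb D$ with $f(0)=0$, $f'(0)=1$ such that $1+zf''(z)/f'(z)$ is analytic in $\mathbb D$ (in particular $f'$ has no zeros) and subordinate to $P$, i.e. $1+zf''(z)/f'(z)=P(\omega(z))$ for some analytic $\omega:\mathbb D\to\mathbb D$ with $\omega(0)=0$. For such $f$, $\log f'$ denotes the analytic branch in $\mathbb D$ with $\log f'(0)=0$, and $a_2(f)=f''(0)/2$. Fix $z_0\in\mathbb D\setminus\{0\}$ and $\lambda\in\mathbb C$ with $|\lambda|\le|A-B|/2$; let $\gamma_1=2\lambda/(A-B)$ and $\sigma_{\gamma_1}(z)=\frac{z+\gamma_1}{1+\overline{\gamma_1}z}$. Let $$V(z_0)=\{\log f'(z_0): f\in\mathcal{CV}(A,B)\},\qquad V(z_0,\lambda)=\{\log f'(z_0): f\in\mathcal{CV}(A,B),\ a_2(f)=\lambda\}.$$ (i) $V(z_0)$ is a convex closed Jordan domain (a Jordan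 curve together with its interior), and it equals $K(\overline{\mathbb D}(0,|z_0|))$, where $\overline{\mathbb D}(0,r)=\{z:|z|\le r\}$ and $K(z)=\int_0^z\frac{A-B}{1+B\zeta}\,d\zeta$ is a convex univalent function in $\mathbb D$ (analytic, injective, with convex image). Furthermore, for every $\varepsilon$ with $|\varepsilon|=1$ and every function $f$ on $\mathbb D$: $f\in\mathcal{CV}(A,B)$ and $\log f'(z_0)=K(\varepsilon z_0)$ if and only if $f(z)=\varepsilon^{-1}F(\varepsilon z)$ for all $z\in\mathbb D$, where $F(z)=\int_0^z e^{K(\zeta)}\,d\zeta$. (ii) If $|\gamma_1|=1$, then $V(z_0,\lambda)=\{w_0\}$ with $w_0=\int_0^{z_0}\zeta^{-1}\{P(\gamma_1\zeta)-1\}\,d\zeta$. (iii) If $|\gamma_1|<1$, then $V(z_0,\lambda)=\{Q_{\gamma_1}(z_0,\varepsilon):|\varepsilon|\le1\}$, where $$Q_{\gamma_1}(z,\varepsilon)=\int_0^{z}\frac{(A-B)\,\sigma_{\gamma_1}(\varepsilon\zeta)}{1+B\zeta\,\sigma_{\gamma_1}(\varepsilon\zeta)}\,d\zeta ,$$ and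 $\varepsilon\mapsto Q_{\gamma_1}(z_0,\varepsilon)$ is convex, univalent and analytic on the closed unit disk (analytic in a neighbourhood of it, injective on it, with convex image). Furthermore, for every $\varepsilon$ with $|\varepsilon|=1$ and every function $f$ on $\mathbb D$: $f\in\mathcal{CV}(A,B)$, $a_2(f)=\lambda$ and $\log f'(z_0)=Q_{\gamma_1}(z_0,\varepsilon)$ if and only if $f(z)=\int_0^z e^{Q_{\gamma_1}(\zeta,\varepsilon)}\,d\zeta$ for all $z\in\mathbb D$. -/

import Mathlib

open Metric Set

noncomputable section

namespace Janowski

/-- The integral of `g` along the straight segment from `0` to `z`. -/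
def segInt (g : ℂ → ℂ) (z : ℂ) : ℂ := ∫ t in (0 : ℝ)..1, z * g ((t : ℂ) * z)

/-- The `k`-th Taylor coefficient of `f` at the origin. -/
def coeff (k : ℕ) (f : ℂ → ℂ) : ℂ := iteratedDeriv k f 0 / (k.factorial : ℂ)

/-- Subordination `g ≺ p` in the unit disk: `g = p ∘ ω` there, for an analytic self-map `ω` of the
unit disk fixing the origin. -/
def Subordinate (g p : ℂ → ℂ) : Prop :=
  ∃ ω : ℂ → ℂ, AnalyticOnNhd ℂ ω (ball 0 1) ∧ ω 0 = 0 ∧ MapsTo ω (ball 0 1) (ball 0 1) ∧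
    ∀ z ∈ ball (0 : ℂ) 1, g z = p (ω z)

/-- The Moebius map `(1 + A z) / (1 + B z)`. -/
def P (A B z : ℂ) : ℂ := (1 + A * z) / (1 + B * z)

/-- The functions analytic in the unit disk with `f 0 = 0` and `f' 0 = 1`. -/
def A₀ : Set (ℂ → ℂ) := {f | AnalyticOnNhd ℂ f (ball 0 1) ∧ f 0 = 0 ∧ deriv f 0 = 1}

/-- The class of `f` in `A₀` such that `z f'' / f' + 1` is an analytic function in the unit disk
subordinate to `P A B`. The quotient is analytic in the disk only if `f'` has no zero there; this is
said explicitly because division by zero is total here. -/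
def CV (A B : ℂ) : Set (ℂ → ℂ) :=
  {f | f ∈ A₀ ∧ (∀ z ∈ ball (0 : ℂ) 1, deriv f z ≠ 0) ∧
    Subordinate (fun z => z * deriv (deriv f) z / deriv f z + 1) (P A B)}

/-- `w = log f' (z)`, for the single-valued analytic branch of `log f'` in the unit disk that
vanishes at the origin. -/
def IsLogDerivAt (f : ℂ → ℂ) (z w : ℂ) : Prop :=
  ∃ L : ℂ → ℂ, AnalyticOnNhd ℂ L (ball 0 1) ∧ L 0 = 0 ∧
    (∀ ζ ∈ ball (0 : ℂ) 1, Complex.exp (L ζ) = deriv f ζ) ∧ L z = w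

/-- The set of all values `log f' (z₀)`, for `f` in `CV A B`. -/
def V (A B z₀ : ℂ) : Set ℂ := {w | ∃ f ∈ CV A B, IsLogDerivAt f z₀ w}

/-- The set of all values `log f' (z₀)`, for `f` in `CV A B` with second coefficient `c`. -/
def VCoeff (A B z₀ c : ℂ) : Set ℂ :=
  {w | ∃ f ∈ CV A B, coeff 2 f = c ∧ IsLogDerivAt f z₀ w}

def K (A B z : ℂ) : ℂ := segInt (fun ζ => (A - B) / (1 + B * ζ)) z

def F (A B z : ℂ) : ℂ := segInt (fun ζ => Complex.exp (K A B ζ)) z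

/-- The disk automorphism `(z + a) / (1 + conj a * z)`. -/
def σ (a z : ℂ) : ℂ := (z + a) / (1 + (starRingEnd ℂ) a * z)

def Q (A B γ z ε : ℂ) : ℂ :=
  segInt (fun ζ => (A - B) * σ γ (ε * ζ) / (1 + B * ζ * σ γ (ε * ζ))) z

/-- `g` is analytic (in a neighbourhood of each point of `S`) and injective on `S`, with convex
image. -/
def ConvexUnivalentOn (g : ℂ → ℂ) (S : Set ℂ) : Prop :=
  AnalyticOnNhd ℂ g S ∧ InjOn g S ∧ Convex ℝ (g '' S)

/-- A closed Jordan domain: a Jordan curve together with the bounded component of its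
complement. -/
def IsClosedJordanDomain (S : Set ℂ) : Prop :=
  ∃ j : Circle → ℂ, Continuous j ∧ Function.Injective j ∧
    ∃ w ∈ (range j)ᶜ, Bornology.IsBounded (connectedComponentIn (range j)ᶜ w) ∧
      S = range j ∪ connectedComponentIn (range j)ᶜ w

end Janowski

end

namespace Janowski

open Filter Topology

/-! By Schwarz's lemma the subordinating function is `ω(z) = z φ(z)` with `φ` analytic and bounded
by one (`IsSchur`). Solving for the logarithm gives `(log f')' = (A - B) φ / (1 + B ζ φ)`, and `f`
is recovered from `φ` by integrating twice. So the two regions are the values at `z₀` of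
`logDerivInt A B φ`, over all Schur `φ`, respectively over those with `φ 0 = γ₁`
(`mem_CV_of_isSchur`, `exists_isSchur_of_mem_CV`).

Convexity: for `u = φ / (1 + B ζ φ)` the bound `|φ| ≤ 1` reads `|u| ≤ |1 - B ζ u|`, a convex
constraint because `|B ζ| ≤ 1` (`IsSchur.exists_combo`).

Extremal functions: the integrand is a Moebius function of a free Schur function `ψ`, with `ψ = φ`
if `φ 0` is free and `φ = σ γ₁ (ζ ψ)` if `|γ₁| < 1`. Compare `ψ` with a nonzero constant `ε`, where
`|ψ| ≤ |ε| ≤ 1`. The difference of the integrals is `κ ε N q`, where `N` is `normalInt` at `ε`, `Re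
q ≤ 0`, and `Re q = 0` only for `ψ = ε` (`exists_moebiusInt_sub`). This is a supporting half-plane;
it yields uniqueness of the extremal functions and injectivity in `ε`. The sign of `Re q` comes from
a comparison of primitives: with `N` as a function of `z`, `Re (1 + z N'' / N') > 0` forces `Re (N /
(z N')) > 0`, and then a primitive of `N' p` with `Re p ≤ 0` is `N q` with `Re q ≤ 0`
(`exists_segInt_eq_mul`).

Constants give all values (`moebiusInt_mem_image`): if `w` is the value of some Schur function and
is omitted by the map `q` of the closed disk of constants, then `-ε q' / (q - w)` is analytic there,
has real part at most zero on the circle and vanishes at the centre. It is therefore constant, which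
contradicts `q' ≠ 0`. When `|γ₁| = 1`, the maximum principle leaves only the constant `φ = γ₁`. -/

theorem analyticOnNhd_of_differentiableOn_ball {g : ℂ → ℂ} {r : ℝ}
    (hg : DifferentiableOn ℂ g (ball 0 r)) : AnalyticOnNhd ℂ g (ball 0 r) :=
  hg.analyticOnNhd isOpen_ball

theorem zero_mem_unitBall : (0 : ℂ) ∈ ball (0 : ℂ) 1 := mem_ball_self one_pos

theorem ofReal_mul_mem_closedBall {t : ℝ} (ht : t ∈ Icc (0 : ℝ) 1) (z : ℂ) :
    (t : ℂ) * z ∈ closedBall (0 : ℂ) ‖z‖ := by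
  rw [mem_closedBall_zero_iff, norm_mul, Complex.norm_real, Real.norm_of_nonneg ht.1]
  exact mul_le_of_le_one_left (norm_nonneg _) ht.2

theorem closedBall_norm_subset_ball {z : ℂ} (hz : z ∈ ball (0 : ℂ) 1) :
    closedBall (0 : ℂ) ‖z‖ ⊆ ball 0 1 :=
  closedBall_subset_ball (mem_ball_zero_iff.1 hz)

theorem ofReal_mul_mem_unitBall {t : ℝ} (ht : t ∈ Icc (0 : ℝ) 1) {z : ℂ}
    (hz : z ∈ ball (0 : ℂ) 1) : (t : ℂ) * z ∈ ball (0 : ℂ) 1 :=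
  closedBall_norm_subset_ball hz (ofReal_mul_mem_closedBall ht z)

/-! ### Integration along radii -/

theorem segInt_congr {g h : ℂ → ℂ} {z : ℂ} (H : ∀ ζ ∈ closedBall (0 : ℂ) ‖z‖, g ζ = h ζ) :
    segInt g z = segInt h z := by
  refine intervalIntegral.integral_congr fun t ht => ?_
  rw [uIcc_of_le zero_le_one] at ht
  simp only [H _ (ofReal_mul_mem_closedBall ht z)]

/-- For `z ≠ 0` the origin is met only at `t = 0`, a null set. This makes integrands with a factor
`ζ⁻¹` harmless. -/
theorem segInt_congr_of_ne {g h : ℂ → ℂ} {z : ℂ}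
    (H : ∀ ζ ∈ closedBall (0 : ℂ) ‖z‖, ζ ≠ 0 → g ζ = h ζ) : segInt g z = segInt h z := by
  rcases eq_or_ne z 0 with rfl | hz
  · simp [segInt]
  · refine intervalIntegral.integral_congr_ae (Eventually.of_forall fun t ht => ?_)
    rw [uIoc_of_le zero_le_one] at ht
    simp only [H _ (ofReal_mul_mem_closedBall ⟨ht.1.le, ht.2⟩ z)
      (mul_ne_zero (by exact_mod_cast ht.1.ne') hz)]

@[simp] theorem segInt_zero_right (g : ℂ → ℂ) : segInt g 0 = 0 := by simp [segInt]

theorem segInt_const_mul (c : ℂ) (g : ℂ → ℂ) (z : ℂ) :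
    segInt (fun ζ => c * g ζ) z = c * segInt g z := by
  simp only [segInt, ← intervalIntegral.integral_const_mul]
  congr 1; ext t; ring

theorem segInt_mul_left (g : ℂ → ℂ) (ε z : ℂ) :
    segInt g (ε * z) = segInt (fun ζ => ε * g (ε * ζ)) z := by
  simp only [segInt]
  congr 1; ext t
  rw [show (t : ℂ) * (ε * z) = ε * (t * z) by ring]; ring

theorem intervalIntegrable_segInt {g : ℂ → ℂ} {z : ℂ}
    (hg : ContinuousOn g (closedBall 0 ‖z‖)) :
    IntervalIntegrable (fun t : ℝ => z * g ((t : ℂ) * z)) MeasureTheory.volume 0 1 := by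
  refine ContinuousOn.intervalIntegrable ?_
  rw [uIcc_of_le zero_le_one]
  refine continuousOn_const.mul (hg.comp (by fun_prop) fun t ht => ofReal_mul_mem_closedBall ht z)

theorem segInt_add {g h : ℂ → ℂ} {z : ℂ} (hg : ContinuousOn g (closedBall 0 ‖z‖))
    (hh : ContinuousOn h (closedBall 0 ‖z‖)) :
    segInt (fun ζ => g ζ + h ζ) z = segInt g z + segInt h z := by
  simp only [segInt]
  rw [← intervalIntegral.integral_add (intervalIntegrable_segInt hg) (intervalIntegrable_segInt hh)]
  congr 1; ext t; ring

theorem segInt_sub {g h : ℂ → ℂ} {z : ℂ} (hg : ContinuousOn g (closedBall 0 ‖z‖))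
    (hh : ContinuousOn h (closedBall 0 ‖z‖)) :
    segInt (fun ζ => g ζ - h ζ) z = segInt g z - segInt h z := by
  simp only [segInt]
  rw [← intervalIntegral.integral_sub (intervalIntegrable_segInt hg) (intervalIntegrable_segInt hh)]
  congr 1; ext t; ring

theorem eq_segInt_of_hasDerivAt {H g : ℂ → ℂ} (hg : ContinuousOn g (ball 0 1))
    (hH : ∀ z ∈ ball (0 : ℂ) 1, HasDerivAt H (g z) z) (h0 : H 0 = 0) {z : ℂ}
    (hz : z ∈ ball (0 : ℂ) 1) : H z = segInt g z := by
  have := intervalIntegral.integral_eq_sub_of_hasDerivAt (a := 0) (b := 1)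
    (f := fun t : ℝ => H ((t : ℂ) * z)) (f' := fun t : ℝ => z * g ((t : ℂ) * z)) ?_
    (intervalIntegrable_segInt (hg.mono (closedBall_norm_subset_ball hz)))
  · simp [segInt, this, h0]
  · intro t ht
    rw [uIcc_of_le zero_le_one] at ht
    have h1 : HasDerivAt (fun s : ℂ => s * z) z (t : ℂ) := by
      simpa using (hasDerivAt_id (t : ℂ)).mul_const z
    have h2 := (hH _ (ofReal_mul_mem_unitBall ht hz)).comp (t : ℂ) h1
    rw [mul_comm]
    exact h2.comp_ofReal

theorem hasDerivAt_segInt {g : ℂ → ℂ} (hg : DifferentiableOn ℂ g (ball 0 1)) {z : ℂ}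
    (hz : z ∈ ball (0 : ℂ) 1) : HasDerivAt (segInt g) (g z) z := by
  obtain ⟨G, hG⟩ := hg.isExactOn_ball
  have h1 : ∀ w ∈ ball (0 : ℂ) 1, HasDerivAt (fun w => G w - G 0) (g w) w := fun w hw =>
    (hG w hw).sub_const _
  refine (h1 z hz).congr_of_eventuallyEq ?_
  filter_upwards [isOpen_ball.mem_nhds hz] with w hw
  exact (eq_segInt_of_hasDerivAt hg.continuousOn h1 (by simp) hw).symm

theorem differentiableOn_segInt {g : ℂ → ℂ} (hg : DifferentiableOn ℂ g (ball 0 1)) :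
    DifferentiableOn ℂ (segInt g) (ball 0 1) := fun _ hz =>
  (hasDerivAt_segInt hg hz).differentiableAt.differentiableWithinAt

theorem hasDerivAt_segInt_param {G G' : ℂ → ℂ → ℂ} {U : Set ℂ} (hU : IsOpen U) {ε z : ℂ}
    (hε : ε ∈ U) (hG : ∀ w ∈ U, ContinuousOn (G w) (closedBall 0 ‖z‖))
    (hG' : ContinuousOn (Function.uncurry G') (U ×ˢ closedBall 0 ‖z‖))
    (hd : ∀ w ∈ U, ∀ ζ ∈ closedBall (0 : ℂ) ‖z‖, HasDerivAt (fun w => G w ζ) (G' w ζ) w) :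
    HasDerivAt (fun w => segInt (G w) z) (segInt (G' ε) z) ε := by
  obtain ⟨ρ, hρ, hρU⟩ := nhds_basis_closedBall.mem_iff.1 (hU.mem_nhds hε)
  -- Compactness of a small disk of parameters times the disk of integration gives the constant
  -- dominating bound.
  obtain ⟨C, hC⟩ := ((isCompact_closedBall ε ρ).prod
    (isCompact_closedBall (0 : ℂ) ‖z‖)).exists_bound_of_continuousOn
    (hG'.mono (prod_mono hρU Subset.rfl))
  have hG'ε : ContinuousOn (G' ε) (closedBall 0 ‖z‖) :=
    hG'.comp (f := fun ζ => (ε, ζ)) (by fun_prop) fun ζ hζ => ⟨hε, hζ⟩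
  refine (intervalIntegral.hasDerivAt_integral_of_dominated_loc_of_deriv_le
    (F := fun w (t : ℝ) => z * G w (t * z)) (F' := fun w (t : ℝ) => z * G' w (t * z))
    (s := closedBall ε ρ) (bound := fun _ => ‖z‖ * C) (closedBall_mem_nhds ε hρ) ?_ ?_ ?_ ?_ ?_
    ?_).2
  · filter_upwards [hU.mem_nhds hε] with w hw
    exact (intervalIntegrable_segInt (hG w hw)).def'.aestronglyMeasurable
  · exact intervalIntegrable_segInt (hG ε hε)
  · exact (intervalIntegrable_segInt hG'ε).def'.aestronglyMeasurable
  · refine Eventually.of_forall fun t ht w hw => ?_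
    rw [uIoc_of_le zero_le_one] at ht
    rw [norm_mul]
    exact mul_le_mul_of_nonneg_left
      (hC (w, t * z) ⟨hw, ofReal_mul_mem_closedBall ⟨ht.1.le, ht.2⟩ z⟩) (norm_nonneg _)
  · exact intervalIntegrable_const
  · refine Eventually.of_forall fun t ht w hw => ?_
    rw [uIoc_of_le zero_le_one] at ht
    exact (hd w (hρU hw) _ (ofReal_mul_mem_closedBall ⟨ht.1.le, ht.2⟩ z)).const_mul z

/-! ### Extrema of real parts of holomorphic functions -/

/-- Rotating `z` stays in the disk, so the angular derivative of `Re q` vanishes and `z q'` is real;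
shrinking `z` also stays in the disk, so the radial derivative is nonnegative. -/
theorem exists_real_of_isMaxOn_re {q : ℂ → ℂ} {q' z : ℂ} {r : ℝ} (hz : z ∈ closedBall (0 : ℂ) r)
    (hq : HasDerivAt q q' z) (hmax : ∀ w ∈ closedBall (0 : ℂ) r, (q w).re ≤ (q z).re) :
    ∃ ρ : ℝ, 0 ≤ ρ ∧ z * q' = ρ := by
  have hz' := mem_closedBall_zero_iff.1 hz
  have him : (z * q').im = 0 := by
    have h1 : HasDerivAt (fun s : ℂ => z * Complex.exp (s * Complex.I)) (z * Complex.I)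
        ((0 : ℝ) : ℂ) := by
      have := (((hasDerivAt_id ((0 : ℝ) : ℂ)).mul_const Complex.I).cexp).const_mul z
      simpa using this
    have h2 : HasDerivAt (fun s : ℂ => q (z * Complex.exp (s * Complex.I))) (q' * (z * Complex.I))
        ((0 : ℝ) : ℂ) := by
      refine HasDerivAt.comp _ ?_ h1
      simpa using hq
    have h3 := h2.real_of_complex
    have h4 : IsLocalMax (fun s : ℝ => (q (z * Complex.exp (s * Complex.I))).re) 0 := by
      refine Eventually.of_forall fun s => ?_
      simp only [Complex.ofReal_zero, zero_mul, Complex.exp_zero, mul_one]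
      refine hmax _ ?_
      rw [mem_closedBall_zero_iff, norm_mul, Complex.norm_exp_ofReal_mul_I, mul_one]
      exact hz'
    have h5 := h4.hasDerivAt_eq_zero h3
    have h6 : (q' * (z * Complex.I)).re = -(z * q').im := by
      rw [show q' * (z * Complex.I) = (z * q') * Complex.I by ring, Complex.mul_I_re]
    linarith
  have hre : 0 ≤ (z * q').re := by
    have h1 : HasDerivAt (fun s : ℂ => q (s * z)) (q' * z) ((1 : ℝ) : ℂ) := by
      refine HasDerivAt.comp _ ?_ (by simpa using (hasDerivAt_id ((1 : ℝ) : ℂ)).mul_const z)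
      simpa using hq
    have h3 := h1.real_of_complex
    have h4 : IsLocalMaxOn (fun s : ℝ => (q (s * z)).re) (Icc 0 1) 1 := by
      refine IsMaxOn.localize fun s hs => ?_
      have hs' := ofReal_mul_mem_closedBall hs z
      simpa using hmax _ (closedBall_subset_closedBall hz' hs')
    -- The direction `-1` points from the endpoint `1` into the interval.
    have h5 := h4.hasFDerivWithinAt_nonpos (y := -1) h3.hasFDerivAt.hasFDerivWithinAt
      (mem_posTangentConeAt_of_segment_subset (by
        norm_num; rw [segment_symm, segment_eq_Icc zero_le_one]))
    rw [mul_comm]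
    simpa using h5
  exact ⟨(z * q').re, hre, Complex.ext rfl (by simpa using him)⟩

theorem exists_mem_closedBall_isMaxOn_re {q : ℂ → ℂ} (hq : ContinuousOn q (ball 0 1)) {z : ℂ}
    (hz : z ∈ ball (0 : ℂ) 1) :
    ∃ z₁ ∈ closedBall (0 : ℂ) ‖z‖, ∀ w ∈ closedBall (0 : ℂ) ‖z‖, (q w).re ≤ (q z₁).re :=
  (isCompact_closedBall (0 : ℂ) ‖z‖).exists_isMaxOn ⟨0, mem_closedBall_self (norm_nonneg _)⟩
    (Complex.continuous_re.comp_continuousOn (hq.mono (closedBall_norm_subset_ball hz)))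

/-- The maximum modulus principle for `exp ∘ q`, whose modulus is `exp (Re q)`. -/
theorem deriv_eq_zero_of_isMaxOn_re {q : ℂ → ℂ} {U : Set ℂ} (hU : IsOpen U)
    (hUc : IsPreconnected U) (hq : DifferentiableOn ℂ q U) {z : ℂ} (hz : z ∈ U)
    (hmax : ∀ w ∈ U, (q w).re ≤ (q z).re) : ∀ w ∈ U, deriv q w = 0 := by
  have h1 : EqOn (fun w => Complex.exp (q w)) (Function.const ℂ (Complex.exp (q z))) U := by
    refine Complex.eqOn_of_isPreconnected_of_isMaxOn_norm hUc hU hq.cexp hz fun w hw => ?_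
    simpa [Complex.norm_exp] using hmax w hw
  intro w hw
  have h2 := ((hq.differentiableAt (hU.mem_nhds hw)).hasDerivAt).cexp
  have h3 : HasDerivAt (fun w => Complex.exp (q w)) 0 w :=
    (hasDerivAt_const w (Complex.exp (q z))).congr_of_eventuallyEq
      (h1.eventuallyEq_of_mem (hU.mem_nhds hw))
  have := h2.unique h3
  simpa [Complex.exp_ne_zero] using this

/-! ### Primitives of functions with a zero at the origin -/

theorem eqOn_ball_of_eqOn_ne_zero {f g : ℂ → ℂ} (hf : ContinuousOn f (ball 0 1))
    (hg : ContinuousOn g (ball 0 1)) (h : ∀ z ∈ ball (0 : ℂ) 1, z ≠ 0 → f z = g z) :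
    ∀ z ∈ ball (0 : ℂ) 1, f z = g z := by
  intro z hz
  rcases eq_or_ne z 0 with rfl | h0
  · have hb := isOpen_ball.mem_nhds hz
    have h1 : Tendsto f (𝓝[≠] 0) (𝓝 (f 0)) := (hf.continuousAt hb).tendsto.mono_left inf_le_left
    have h2 : Tendsto g (𝓝[≠] 0) (𝓝 (g 0)) := (hg.continuousAt hb).tendsto.mono_left inf_le_left
    refine tendsto_nhds_unique h1 (h2.congr' ?_)
    filter_upwards [self_mem_nhdsWithin, mem_nhdsWithin_of_mem_nhds hb] with w hw hwb
    exact (h w hwb hw).symm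
  · exact h z hz h0

theorem exists_eq_mul_of_zero {H : ℂ → ℂ} (hH : DifferentiableOn ℂ H (ball 0 1)) (h0 : H 0 = 0) :
    ∃ H₁ : ℂ → ℂ, DifferentiableOn ℂ H₁ (ball 0 1) ∧ ∀ z, H z = z * H₁ z := by
  refine ⟨dslope H 0, (Complex.differentiableOn_dslope (ball_mem_nhds 0 one_pos)).2 hH, fun z => ?_⟩
  have := sub_smul_dslope H 0 z
  simp only [sub_zero, h0, smul_eq_mul] at this
  exact this.symm

/-- Factoring out the zero of order `j + 1` turns `H' = z ^ j g` into a differential equation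
without singularity at the origin. Induction on `j` works because that equation, read at `0` for the
right side `z g z`, forces one more zero. -/
theorem exists_eq_pow_mul_of_hasDerivAt (j : ℕ) : ∀ {H g : ℂ → ℂ},
    DifferentiableOn ℂ g (ball 0 1) → H 0 = 0 →
    (∀ z ∈ ball (0 : ℂ) 1, HasDerivAt H (z ^ j * g z) z) →
    ∃ H₁ : ℂ → ℂ, DifferentiableOn ℂ H₁ (ball 0 1) ∧
      (∀ z ∈ ball (0 : ℂ) 1, H z = z ^ (j + 1) * H₁ z) ∧
      ∀ z ∈ ball (0 : ℂ) 1, (j + 1) * H₁ z + z * deriv H₁ z = g z := by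
  have ode (i : ℕ) {H g H₁ : ℂ → ℂ} (hg : DifferentiableOn ℂ g (ball 0 1))
      (hH : ∀ z ∈ ball (0 : ℂ) 1, HasDerivAt H (z ^ i * g z) z)
      (hd : DifferentiableOn ℂ H₁ (ball 0 1))
      (h : ∀ z ∈ ball (0 : ℂ) 1, H z = z ^ (i + 1) * H₁ z) :
      ∀ z ∈ ball (0 : ℂ) 1, (i + 1) * H₁ z + z * deriv H₁ z = g z := by
    have hdd : DifferentiableOn ℂ (deriv H₁) (ball 0 1) := hd.deriv isOpen_ball
    -- Away from the origin the factor `z ^ i` cancels from the two expressions for the derivative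
    -- of `H`; continuity covers the origin.
    refine eqOn_ball_of_eqOn_ne_zero ((continuousOn_const.mul hd.continuousOn).add
      (continuousOn_id.mul hdd.continuousOn)) hg.continuousOn fun z hz hz0 => ?_
    have h1 := (hasDerivAt_pow (i + 1) z).mul
      (hd.differentiableAt (isOpen_ball.mem_nhds hz)).hasDerivAt
    have h2 := (hH z hz).congr_of_eventuallyEq
      (f₁ := fun w => w ^ (i + 1) * H₁ w)
      (by filter_upwards [isOpen_ball.mem_nhds hz] with w hw; exact (h w hw).symm)
    have h3 := h1.unique h2
    refine mul_left_cancel₀ (pow_ne_zero i hz0) ?_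
    rw [← h3]; push_cast; ring_nf
  induction j with
  | zero =>
    intro H g hg h0 hH
    obtain ⟨H₁, hd, h⟩ := exists_eq_mul_of_zero (H := H)
      (fun z hz => (hH z hz).differentiableAt.differentiableWithinAt) h0
    have h' : ∀ z ∈ ball (0 : ℂ) 1, H z = z ^ (0 + 1) * H₁ z := fun z _ => by simp [h z]
    exact ⟨H₁, hd, h', ode 0 hg hH hd h'⟩
  | succ j ih =>
    intro H g hg h0 hH
    obtain ⟨H₁, hd, h1, h2⟩ := ih (H := H) (g := fun z => z * g z) (differentiableOn_id.mul hg) h0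
      fun z hz => by simpa [pow_succ, mul_assoc] using hH z hz
    have h3 : H₁ 0 = 0 := by
      have := h2 0 zero_mem_unitBall
      simp only [zero_mul, add_zero, mul_eq_zero] at this
      exact this.resolve_left (by exact_mod_cast j.succ_ne_zero)
    obtain ⟨H₂, hd2, h4⟩ := exists_eq_mul_of_zero hd h3
    have h' : ∀ z ∈ ball (0 : ℂ) 1, H z = z ^ (j + 1 + 1) * H₂ z := fun z hz => by
      rw [h1 z hz, h4 z]; ring
    exact ⟨H₂, hd2, h', by exact_mod_cast ode (j + 1) hg hH hd2 h'⟩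

/-! ### Comparison of primitives with a starlike primitive -/

/-- With `H = z ^ (j + 1) h` and `H' = z ^ j k`, this is the passage from convexity, `Re (1 + z H''
/ H') > 0`, to starlikeness, in the form `Re (H / (z H')) > 0`. It suffices to look at a point of a
closed disk where `Re (h / k)` is least. -/
theorem re_div_pos_of_re_add_pos {j : ℕ} {k h : ℂ → ℂ} (hk : DifferentiableOn ℂ k (ball 0 1))
    (hk0 : ∀ z ∈ ball (0 : ℂ) 1, k z ≠ 0)
    (hc : ∀ z ∈ ball (0 : ℂ) 1, 0 < (j + 1 + z * deriv k z / k z).re)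
    (hh : DifferentiableOn ℂ h (ball 0 1))
    (hode : ∀ z ∈ ball (0 : ℂ) 1, (j + 1) * h z + z * deriv h z = k z) :
    ∀ z ∈ ball (0 : ℂ) 1, 0 < (h z / k z).re := by
  intro z hz
  obtain ⟨z₁, hz₁, hmax⟩ := exists_mem_closedBall_isMaxOn_re (q := fun z => -(h z / k z))
    (hh.continuousOn.div hk.continuousOn hk0).neg hz
  have hb := closedBall_norm_subset_ball hz hz₁
  have hdk := (hk.differentiableAt (isOpen_ball.mem_nhds hb)).hasDerivAt
  have hdh := (hh.differentiableAt (isOpen_ball.mem_nhds hb)).hasDerivAt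
  obtain ⟨ρ, hρ, hρe⟩ := exists_real_of_isMaxOn_re hz₁ ((hdh.div hdk (hk0 _ hb)).neg) hmax
  have hle := hmax z (mem_closedBall_zero_iff.2 le_rfl)
  simp only [Complex.neg_re] at hle
  refine lt_of_lt_of_le ?_ (neg_le_neg_iff.1 hle)
  set c := (j + 1 + z₁ * deriv k z₁ / k z₁ : ℂ) with hcdef
  have hk1 := hk0 _ hb
  -- The equation gives `(h / k) c = 1 - z (h / k)'`, and `-z (h / k)' = ρ ≥ 0` at the minimum.
  have hs : h z₁ / k z₁ * c = ((1 + ρ : ℝ) : ℂ) := by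
    have e := hode z₁ hb
    push_cast
    rw [← hρe, hcdef]
    field_simp
    linear_combination (k z₁) * e
  have hcpos := hc z₁ hb
  have hc0 : c ≠ 0 := fun h => by rw [← hcdef, h] at hcpos; simp at hcpos
  rw [eq_div_of_mul_eq hc0 hs, div_eq_mul_inv, Complex.re_ofReal_mul, Complex.inv_re]
  have : 0 < Complex.normSq c := Complex.normSq_pos.2 hc0
  have : 0 < c.re := hcpos
  positivity

/-- The quotient `q` of the two primitives satisfies `p = q + z q' (h / k)` with `Re (h / k) > 0`.
Where `Re q` is greatest on a closed disk, `z q'` is real and nonnegative, so `Re q ≤ Re p ≤ 0`. If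
`Re q` reaches `0`, then `q` is constant and `p = q`. -/
theorem exists_segInt_eq_mul {j : ℕ} {k p : ℂ → ℂ} (hk : DifferentiableOn ℂ k (ball 0 1))
    (hk0 : ∀ z ∈ ball (0 : ℂ) 1, k z ≠ 0)
    (hc : ∀ z ∈ ball (0 : ℂ) 1, 0 < (j + 1 + z * deriv k z / k z).re)
    (hp : DifferentiableOn ℂ p (ball 0 1)) (hp0 : ∀ z ∈ ball (0 : ℂ) 1, (p z).re ≤ 0) :
    ∃ q : ℂ → ℂ,
      (∀ z ∈ ball (0 : ℂ) 1,
        segInt (fun ζ => ζ ^ j * (k ζ * p ζ)) z = segInt (fun ζ => ζ ^ j * k ζ) z * q z) ∧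
      (∀ z ∈ ball (0 : ℂ) 1, (q z).re ≤ 0) ∧
      (∀ z ∈ ball (0 : ℂ) 1, (q z).re = 0 → ∀ w ∈ ball (0 : ℂ) 1, (p w).re = 0) ∧
      ∀ z ∈ ball (0 : ℂ) 1, z ≠ 0 → segInt (fun ζ => ζ ^ j * k ζ) z ≠ 0 := by
  have hpow : DifferentiableOn ℂ (fun ζ : ℂ => ζ ^ j) (ball 0 1) := by fun_prop
  obtain ⟨h, hh, hhe, hho⟩ := exists_eq_pow_mul_of_hasDerivAt j
    (H := segInt fun ζ => ζ ^ j * k ζ) hk (segInt_zero_right _)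
    fun z hz => hasDerivAt_segInt (hpow.mul hk) hz
  obtain ⟨i, hi, hie, hio⟩ := exists_eq_pow_mul_of_hasDerivAt j
    (H := segInt fun ζ => ζ ^ j * (k ζ * p ζ)) (g := fun ζ => k ζ * p ζ) (hk.mul hp)
    (segInt_zero_right _)
    fun z hz => hasDerivAt_segInt (hpow.mul (hk.mul hp)) hz
  have hs := re_div_pos_of_re_add_pos hk hk0 hc hh hho
  have hh0 : ∀ z ∈ ball (0 : ℂ) 1, h z ≠ 0 := fun z hz h0 => by simpa [h0] using hs z hz
  have hq : DifferentiableOn ℂ (fun z => i z / h z) (ball 0 1) := hi.div hh hh0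
  have hqd : ∀ z ∈ ball (0 : ℂ) 1, HasDerivAt (fun z => i z / h z)
      ((deriv i z * h z - i z * deriv h z) / h z ^ 2) z := fun z hz =>
    (hi.differentiableAt (isOpen_ball.mem_nhds hz)).hasDerivAt.div
      (hh.differentiableAt (isOpen_ball.mem_nhds hz)).hasDerivAt (hh0 z hz)
  have key : ∀ z ∈ ball (0 : ℂ) 1, p z = i z / h z +
      z * ((deriv i z * h z - i z * deriv h z) / h z ^ 2) * (h z / k z) := by
    intro z hz
    have h1 := hk0 z hz
    have h2 := hh0 z hz
    have e1 := hho z hz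
    have e2 := hio z hz
    field_simp
    linear_combination (-h z) * e2 + i z * e1
  have hle : ∀ z ∈ ball (0 : ℂ) 1, (i z / h z).re ≤ 0 := by
    intro z hz
    obtain ⟨z₁, hz₁, hmax⟩ := exists_mem_closedBall_isMaxOn_re hq.continuousOn hz
    have hb := closedBall_norm_subset_ball hz hz₁
    obtain ⟨ρ, hρ, hρe⟩ := exists_real_of_isMaxOn_re hz₁ (hqd _ hb) hmax
    have e := congrArg Complex.re (key z₁ hb)
    rw [hρe, Complex.add_re, Complex.re_ofReal_mul] at e
    have h1 := hmax z (mem_closedBall_zero_iff.2 le_rfl)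
    have h2 := mul_nonneg hρ (hs z₁ hb).le
    have h3 := hp0 z₁ hb
    linarith
  refine ⟨fun z => i z / h z, fun z hz => ?_, hle, fun z hz hz0 w hw => ?_, fun z hz hz0 => ?_⟩
  · have := hh0 z hz
    rw [hie z hz, hhe z hz]; field_simp
  · have hder := deriv_eq_zero_of_isMaxOn_re isOpen_ball (convex_ball (0 : ℂ) 1).isPreconnected
      hq hz fun w hw => by simpa [hz0] using hle w hw
    have hpq : ∀ w ∈ ball (0 : ℂ) 1, p w = i w / h w := fun w hw => by
      have h1 := key w hw
      rwa [← (hqd w hw).deriv, hder w hw, mul_zero, zero_mul, add_zero] at h1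
    rw [hpq w hw, isOpen_ball.is_const_of_deriv_eq_zero (convex_ball (0 : ℂ) 1).isPreconnected
      hq (fun x hx => hder x hx) hw hz]
    exact hz0
  · rw [hhe z hz]
    exact mul_ne_zero (pow_ne_zero _ hz0) (hh0 z hz)

/-! ### Moebius kernels and supporting half-planes -/

/-- `ψ` is analytic in the unit disk and bounded by one there. -/
def IsSchur (ψ : ℂ → ℂ) : Prop :=
  DifferentiableOn ℂ ψ (ball 0 1) ∧ ∀ z ∈ ball (0 : ℂ) 1, ‖ψ z‖ ≤ 1

theorem isSchur_const {ε : ℂ} (hε : ‖ε‖ ≤ 1) : IsSchur fun _ => ε :=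
  ⟨differentiableOn_const _, fun _ _ => hε⟩

/-- Conditions under which the integrals over a radius of the Moebius maps
`w ↦ (α ζ + β ζ * w) / (d₀ ζ + d₁ ζ * w)` attain their extreme values at constant functions. -/
structure IsMoebiusKernel (α β d₀ d₁ : ℂ → ℂ) (j : ℕ) (κ : ℂ) : Prop where
  diff_α : Differentiable ℂ α
  diff_β : Differentiable ℂ β
  diff_d₀ : Differentiable ℂ d₀
  diff_d₁ : Differentiable ℂ d₁
  κ_ne : κ ≠ 0
  -- The determinant is the numerator of the `w`-derivative; its zero of order `j` at the origin is
  -- the factor `ζ ^ j` of `normalInt`.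
  det : ∀ ζ, β ζ * d₀ ζ - α ζ * d₁ ζ = κ * ζ ^ j
  d₀_ne : ∀ ζ ∈ ball (0 : ℂ) 1, d₀ ζ ≠ 0
  norm_le : ∀ ζ ∈ ball (0 : ℂ) 1, ‖d₁ ζ‖ ≤ ‖ζ‖ * ‖d₀ ζ‖
  -- This is `Re (1 + z H'' / H') > 0` for the primitive `H` with `H' = ζ ^ j (d₀ + d₁ ε)⁻²`.
  re_pos : ∀ ζ ∈ ball (0 : ℂ) 1, ∀ ε : ℂ, ‖ε‖ ≤ 1 →
    0 < (j + 1 - 2 * (ζ * (deriv d₀ ζ + deriv d₁ ζ * ε) / (d₀ ζ + d₁ ζ * ε))).re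

/-- The Moebius map in `w` with coefficients depending on `ζ`. -/
noncomputable def moebius (α β d₀ d₁ : ℂ → ℂ) (ζ w : ℂ) : ℂ := (α ζ + β ζ * w) / (d₀ ζ + d₁ ζ * w)

/-- The integral of `moebius` over a radius, along a function `ψ`. -/
noncomputable def moebiusInt (α β d₀ d₁ : ℂ → ℂ) (ψ : ℂ → ℂ) (z : ℂ) : ℂ :=
  segInt (fun ζ => moebius α β d₀ d₁ ζ (ψ ζ)) z

/-- The Moebius map `v ↦ (v - 1)(1 + m) / (1 + m v)` has its pole outside the closed unit disk,
vanishes at `v = 1` and has derivative `1` there. It maps the closed disk onto a closed disk in the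
left half-plane, tangent to the imaginary axis at `0`. -/
theorem re_mul_div_le {m v : ℂ} (hm : ‖m‖ < 1) (hv : ‖v‖ ≤ 1) :
    ((v - 1) * ((1 + m) / (1 + m * v))).re ≤ 0 ∧
      (((v - 1) * ((1 + m) / (1 + m * v))).re = 0 → v = 1) := by
  have hne : 1 + m * v ≠ 0 := by
    intro h
    have : ‖m * v‖ = 1 := by rw [← neg_eq_of_add_eq_zero_right h]; simp
    rw [norm_mul] at this
    nlinarith [norm_nonneg m, norm_nonneg v]
  have hpos := Complex.normSq_pos.2 hne
  have e : ((v - 1) * ((1 + m) / (1 + m * v))).re * Complex.normSq (1 + m * v) =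
      (Complex.normSq v - 1) / 2 * Complex.normSq (1 + m) -
        Complex.normSq (v - 1) * ((1 - Complex.normSq m) / 2) := by
    have h : (v - 1) * ((1 + m) / (1 + m * v)) =
        (v - 1) * (1 + m) * (starRingEnd ℂ) (1 + m * v) / (Complex.normSq (1 + m * v) : ℂ) := by
      rw [Complex.normSq_eq_conj_mul_self]
      have := (map_ne_zero (starRingEnd ℂ)).2 hne
      rw [mul_div_assoc', mul_comm ((starRingEnd ℂ) _), mul_div_mul_right _ _ this]
    rw [h, Complex.div_ofReal_re, div_mul_cancel₀ _ hpos.ne']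
    simp only [Complex.conj_re, Complex.conj_im, Complex.normSq_apply, Complex.mul_re, Complex.mul_im, Complex.add_re,
      Complex.add_im, Complex.sub_re, Complex.sub_im, Complex.one_re, Complex.one_im]
    ring
  have hv' : Complex.normSq v ≤ 1 := by
    rw [Complex.normSq_eq_norm_sq]; nlinarith [norm_nonneg v]
  have hm' : Complex.normSq m < 1 := by
    rw [Complex.normSq_eq_norm_sq]; nlinarith [norm_nonneg m]
  have h1 : 0 ≤ (1 - Complex.normSq v) / 2 * Complex.normSq (1 + m) :=
    mul_nonneg (by linarith) (Complex.normSq_nonneg _)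
  have h2 : 0 ≤ Complex.normSq (v - 1) * ((1 - Complex.normSq m) / 2) :=
    mul_nonneg (Complex.normSq_nonneg _) (by linarith)
  refine ⟨?_, fun h => ?_⟩
  · by_contra! h
    nlinarith [mul_pos h hpos]
  · rw [h, zero_mul] at e
    have h3 : Complex.normSq (v - 1) * ((1 - Complex.normSq m) / 2) = 0 := by linarith
    have h4 := (mul_eq_zero.1 h3).resolve_right (by linarith)
    exact sub_eq_zero.1 (Complex.normSq_eq_zero.1 h4)

namespace IsMoebiusKernel

variable {α β d₀ d₁ : ℂ → ℂ} {j : ℕ} {κ : ℂ}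

theorem denom_ne (M : IsMoebiusKernel α β d₀ d₁ j κ) {ζ w : ℂ} (hζ : ζ ∈ ball (0 : ℂ) 1)
    (hw : ‖ζ‖ * ‖w‖ < 1) : d₀ ζ + d₁ ζ * w ≠ 0 := by
  intro h
  have h1 := M.norm_le ζ hζ
  have h2 := norm_pos_iff.2 (M.d₀_ne ζ hζ)
  have h3 : ‖d₀ ζ‖ = ‖d₁ ζ‖ * ‖w‖ := by
    rw [← norm_mul, ← norm_neg (d₁ ζ * w), ← eq_neg_of_add_eq_zero_left h]
  nlinarith [norm_nonneg w, mul_le_mul_of_nonneg_right h1 (norm_nonneg w)]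

theorem denom_ne_of_le (M : IsMoebiusKernel α β d₀ d₁ j κ) {ζ w : ℂ} (hζ : ζ ∈ ball (0 : ℂ) 1)
    (hw : ‖w‖ ≤ 1) : d₀ ζ + d₁ ζ * w ≠ 0 :=
  M.denom_ne hζ (by nlinarith [mem_ball_zero_iff.1 hζ, norm_nonneg ζ, norm_nonneg w])

theorem differentiableOn_moebius (M : IsMoebiusKernel α β d₀ d₁ j κ) {ψ : ℂ → ℂ}
    (hψ : IsSchur ψ) : DifferentiableOn ℂ (fun ζ => moebius α β d₀ d₁ ζ (ψ ζ)) (ball 0 1) :=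
  (M.diff_α.differentiableOn.add (M.diff_β.differentiableOn.mul hψ.1)).div
    (M.diff_d₀.differentiableOn.add (M.diff_d₁.differentiableOn.mul hψ.1))
    fun ζ hζ => M.denom_ne_of_le hζ (hψ.2 ζ hζ)

/-- The primitive whose multiples are the outward normals of the variability region. -/
noncomputable def normalInt (d₀ d₁ : ℂ → ℂ) (j : ℕ) (ε z : ℂ) : ℂ :=
  segInt (fun ζ => ζ ^ j * ((d₀ ζ + d₁ ζ * ε) ^ 2)⁻¹) z

/-- With `D = d₀ + d₁ ε` and `E = d₀ + d₁ ψ`, the integrands differ by `κ ζ ^ j (ψ - ε) / (D E) = κ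
ε ζ ^ j D⁻² p`, where `p = (ψ / ε - 1) D / E`. Since `Re p ≤ 0` by `re_mul_div_le`, the comparison
of primitives applies with `k = D⁻²`. -/
theorem exists_moebiusInt_sub (M : IsMoebiusKernel α β d₀ d₁ j κ) {ψ : ℂ → ℂ}
    (hψ : DifferentiableOn ℂ ψ (ball 0 1)) {ε : ℂ} (hε0 : ε ≠ 0) (hε : ‖ε‖ ≤ 1)
    (hψε : ∀ z ∈ ball (0 : ℂ) 1, ‖ψ z‖ ≤ ‖ε‖) {z : ℂ} (hz : z ∈ ball (0 : ℂ) 1) (hz0 : z ≠ 0) :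
    normalInt d₀ d₁ j ε z ≠ 0 ∧
    ∃ q : ℂ, moebiusInt α β d₀ d₁ ψ z - moebiusInt α β d₀ d₁ (fun _ => ε) z =
      κ * ε * normalInt d₀ d₁ j ε z * q ∧ q.re ≤ 0 ∧
      (q.re = 0 → ∀ w ∈ ball (0 : ℂ) 1, ψ w = ε) := by
  have hS : IsSchur ψ := ⟨hψ, fun w hw => (hψε w hw).trans hε⟩
  have hDd : DifferentiableOn ℂ (fun ζ => d₀ ζ + d₁ ζ * ε) (ball 0 1) :=
    M.diff_d₀.differentiableOn.add (M.diff_d₁.differentiableOn.mul_const _)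
  have hD0 : ∀ ζ ∈ ball (0 : ℂ) 1, d₀ ζ + d₁ ζ * ε ≠ 0 := fun ζ hζ => M.denom_ne_of_le hζ hε
  have hE0 : ∀ ζ ∈ ball (0 : ℂ) 1, d₀ ζ + d₁ ζ * ψ ζ ≠ 0 := fun ζ hζ =>
    M.denom_ne_of_le hζ (hS.2 ζ hζ)
  have hp : ∀ ζ ∈ ball (0 : ℂ) 1,
      (((ψ ζ / ε - 1) * ((d₀ ζ + d₁ ζ * ε) / (d₀ ζ + d₁ ζ * ψ ζ))).re ≤ 0 ∧
      (((ψ ζ / ε - 1) * ((d₀ ζ + d₁ ζ * ε) / (d₀ ζ + d₁ ζ * ψ ζ))).re = 0 → ψ ζ = ε)) := by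
    intro ζ hζ
    have hd := M.d₀_ne ζ hζ
    have hm : ‖d₁ ζ * ε / d₀ ζ‖ < 1 := by
      rw [norm_div, norm_mul, div_lt_one (norm_pos_iff.2 hd)]
      have h1 := M.norm_le ζ hζ
      have h2 := norm_pos_iff.2 hd
      have h3 := mem_ball_zero_iff.1 hζ
      nlinarith [norm_nonneg (d₁ ζ), norm_nonneg ε]
    have hv : ‖ψ ζ / ε‖ ≤ 1 := by
      rw [norm_div, div_le_one (norm_pos_iff.2 hε0)]; exact hψε ζ hζ
    have h1 := re_mul_div_le hm hv
    -- Here `m = d₁ ε / d₀` and `v = ψ / ε`.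
    have e : (1 + d₁ ζ * ε / d₀ ζ) / (1 + d₁ ζ * ε / d₀ ζ * (ψ ζ / ε)) =
        (d₀ ζ + d₁ ζ * ε) / (d₀ ζ + d₁ ζ * ψ ζ) := by
      have e1 : 1 + d₁ ζ * ε / d₀ ζ = (d₀ ζ + d₁ ζ * ε) / d₀ ζ := by field_simp
      have e2 : 1 + d₁ ζ * ε / d₀ ζ * (ψ ζ / ε) = (d₀ ζ + d₁ ζ * ψ ζ) / d₀ ζ := by field_simp
      rw [e1, e2, div_div_div_cancel_right₀ hd]
    rw [e] at h1
    exact ⟨h1.1, fun h => by have := h1.2 h; rwa [div_eq_one_iff_eq hε0] at this⟩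
  have hpd : DifferentiableOn ℂ
      (fun ζ => (ψ ζ / ε - 1) * ((d₀ ζ + d₁ ζ * ε) / (d₀ ζ + d₁ ζ * ψ ζ))) (ball 0 1) :=
    ((hψ.div_const _).sub_const _).mul (hDd.div
      (M.diff_d₀.differentiableOn.add (M.diff_d₁.differentiableOn.mul hψ)) hE0)
  have hcD : ∀ ζ ∈ ball (0 : ℂ) 1, 0 < (j + 1 + ζ * deriv (fun ζ => ((d₀ ζ + d₁ ζ * ε) ^ 2)⁻¹) ζ /
      ((d₀ ζ + d₁ ζ * ε) ^ 2)⁻¹).re := by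
    intro ζ hζ
    have h1 := hD0 ζ hζ
    have h2 : HasDerivAt (fun ζ => d₀ ζ + d₁ ζ * ε) (deriv d₀ ζ + deriv d₁ ζ * ε) ζ :=
      (M.diff_d₀ ζ).hasDerivAt.add ((M.diff_d₁ ζ).hasDerivAt.mul_const _)
    have h3 := ((h2.pow 2).inv (pow_ne_zero 2 h1)).deriv
    have h4 := M.re_pos ζ hζ ε hε
    have e : ζ * deriv (fun ζ => ((d₀ ζ + d₁ ζ * ε) ^ 2)⁻¹) ζ / ((d₀ ζ + d₁ ζ * ε) ^ 2)⁻¹ =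
        -(2 * (ζ * (deriv d₀ ζ + deriv d₁ ζ * ε) / (d₀ ζ + d₁ ζ * ε))) := by
      refine (congrArg (fun x => ζ * x / ((d₀ ζ + d₁ ζ * ε) ^ 2)⁻¹) h3).trans ?_
      simp only [Pi.pow_apply]
      field_simp
      simp
      ring
    rw [e, ← sub_eq_add_neg]
    exact h4
  obtain ⟨q, hq1, hq2, hq3, hq4⟩ := exists_segInt_eq_mul (j := j)
    (k := fun ζ => ((d₀ ζ + d₁ ζ * ε) ^ 2)⁻¹)
    ((hDd.pow 2).inv fun ζ hζ => pow_ne_zero 2 (hD0 ζ hζ))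
    (fun ζ hζ => inv_ne_zero (pow_ne_zero 2 (hD0 ζ hζ))) hcD hpd fun ζ hζ => (hp ζ hζ).1
  · refine ⟨hq4 z hz hz0, q z, ?_, hq2 z hz, fun h w hw => (hp w hw).2 (hq3 z hz h w hw)⟩
    rw [moebiusInt, moebiusInt, ← segInt_sub
      ((M.differentiableOn_moebius hS).continuousOn.mono (closedBall_norm_subset_ball hz))
      ((M.differentiableOn_moebius (isSchur_const hε)).continuousOn.mono
        (closedBall_norm_subset_ball hz)), mul_assoc (κ * ε), normalInt, ← hq1 z hz,
      ← segInt_const_mul]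
    refine segInt_congr fun ζ hζ => ?_
    have hζ' := closedBall_norm_subset_ball hz hζ
    have h1 := hD0 ζ hζ'
    have h2 := hE0 ζ hζ'
    have h3 : (α ζ + β ζ * ψ ζ) * (d₀ ζ + d₁ ζ * ε) - (α ζ + β ζ * ε) * (d₀ ζ + d₁ ζ * ψ ζ) =
        (ψ ζ - ε) * (κ * ζ ^ j) := by linear_combination (ψ ζ - ε) * M.det ζ
    simp only [moebius]
    rw [div_sub_div _ _ h2 h1, mul_comm (d₀ ζ + d₁ ζ * ψ ζ) (α ζ + β ζ * ε), h3]
    generalize d₀ ζ + d₁ ζ * ψ ζ = E at *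
    generalize d₀ ζ + d₁ ζ * ε = D at *
    field_simp

theorem eq_of_moebiusInt_eq (M : IsMoebiusKernel α β d₀ d₁ j κ) {ψ : ℂ → ℂ}
    (hψ : DifferentiableOn ℂ ψ (ball 0 1)) {ε : ℂ} (hε : ‖ε‖ ≤ 1)
    (hψε : ∀ z ∈ ball (0 : ℂ) 1, ‖ψ z‖ ≤ ‖ε‖) {z : ℂ} (hz : z ∈ ball (0 : ℂ) 1) (hz0 : z ≠ 0)
    (h : moebiusInt α β d₀ d₁ ψ z = moebiusInt α β d₀ d₁ (fun _ => ε) z) :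
    ∀ w ∈ ball (0 : ℂ) 1, ψ w = ε := by
  rcases eq_or_ne ε 0 with rfl | hε0
  · exact fun w hw => by simpa using hψε w hw
  obtain ⟨h0, q, hq, -, hq'⟩ := M.exists_moebiusInt_sub hψ hε0 hε hψε hz hz0
  rw [h, sub_self, eq_comm] at hq
  have := (mul_eq_zero.1 hq).resolve_left (mul_ne_zero (mul_ne_zero M.κ_ne hε0) h0)
  exact hq' (by simp [this])

theorem injOn (M : IsMoebiusKernel α β d₀ d₁ j κ) {z : ℂ} (hz : z ∈ ball (0 : ℂ) 1)
    (hz0 : z ≠ 0) : InjOn (fun ε => moebiusInt α β d₀ d₁ (fun _ => ε) z) (closedBall 0 1) := by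
  -- The constant of smaller modulus plays the part of `ψ`, so the comparison holds inside the disk
  -- as well as on the circle.
  have key : ∀ a ∈ closedBall (0 : ℂ) 1, ∀ b ∈ closedBall (0 : ℂ) 1, ‖a‖ ≤ ‖b‖ →
      moebiusInt α β d₀ d₁ (fun _ => a) z = moebiusInt α β d₀ d₁ (fun _ => b) z → a = b :=
    fun a _ b hb hab h => M.eq_of_moebiusInt_eq (differentiableOn_const _)
      (mem_closedBall_zero_iff.1 hb) (fun _ _ => hab) hz hz0 h 0 zero_mem_unitBall
  intro a ha b hb h
  rcases le_total ‖a‖ ‖b‖ with hab | hab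
  · exact key a ha b hb hab h
  · exact (key b hb a ha hab h.symm).symm

theorem hasDerivAt_moebiusInt (M : IsMoebiusKernel α β d₀ d₁ j κ) {z ε : ℂ}
    (hz : z ∈ ball (0 : ℂ) 1) (hε : ‖z‖ * ‖ε‖ < 1) :
    HasDerivAt (fun ε => moebiusInt α β d₀ d₁ (fun _ => ε) z) (κ * normalInt d₀ d₁ j ε z) ε := by
  have hden : ∀ w ∈ {w : ℂ | ‖z‖ * ‖w‖ < 1}, ∀ ζ ∈ closedBall (0 : ℂ) ‖z‖,
      d₀ ζ + d₁ ζ * w ≠ 0 := fun w hw ζ hζ => M.denom_ne (closedBall_norm_subset_ball hz hζ)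
    ((mul_le_mul_of_nonneg_right (mem_closedBall_zero_iff.1 hζ) (norm_nonneg w)).trans_lt hw)
  have h0 := M.diff_d₀.continuous
  have h1 := M.diff_d₁.continuous
  have h2 := M.diff_α.continuous
  have h3 := M.diff_β.continuous
  rw [normalInt, ← segInt_const_mul]
  refine hasDerivAt_segInt_param (G := fun w ζ => moebius α β d₀ d₁ ζ w)
    (G' := fun w ζ => κ * (ζ ^ j * ((d₀ ζ + d₁ ζ * w) ^ 2)⁻¹))
    (U := {w : ℂ | ‖z‖ * ‖w‖ < 1}) (isOpen_lt (by fun_prop) continuous_const) hε (fun w hw => ?_) ?_ fun w hw ζ hζ => ?_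
  · exact ContinuousOn.div (by fun_prop) (by fun_prop) fun ζ hζ => hden w hw ζ hζ
  · refine ContinuousOn.mul continuousOn_const (ContinuousOn.mul (by fun_prop)
      (ContinuousOn.inv₀ (by fun_prop) ?_))
    rintro ⟨w, ζ⟩ ⟨hw, hζ⟩
    exact pow_ne_zero 2 (hden w hw ζ hζ)
  · have h4 := hden w hw ζ hζ
    have h5 := (((hasDerivAt_id w).const_mul (β ζ)).const_add (α ζ)).div
      (((hasDerivAt_id w).const_mul (d₁ ζ)).const_add (d₀ ζ)) h4
    refine h5.congr_deriv ?_
    simp only [id]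
    field_simp
    linear_combination M.det ζ

end IsMoebiusKernel

/-! ### Constant Schur functions give all values -/

namespace IsMoebiusKernel

variable {α β d₀ d₁ : ℂ → ℂ} {j : ℕ} {κ : ℂ}

theorem differentiableOn_moebiusInt (M : IsMoebiusKernel α β d₀ d₁ j κ) {z : ℂ}
    (hz : z ∈ ball (0 : ℂ) 1) :
    DifferentiableOn ℂ (fun ε => moebiusInt α β d₀ d₁ (fun _ => ε) z) {ε | ‖z‖ * ‖ε‖ < 1} :=
  fun _ hε => (M.hasDerivAt_moebiusInt hz hε).differentiableAt.differentiableWithinAt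

theorem isOpen_param (z : ℂ) : IsOpen {ε : ℂ | ‖z‖ * ‖ε‖ < 1} :=
  isOpen_lt (by fun_prop) continuous_const

theorem closedBall_subset_param {z : ℂ} (hz : z ∈ ball (0 : ℂ) 1) :
    closedBall (0 : ℂ) 1 ⊆ {ε : ℂ | ‖z‖ * ‖ε‖ < 1} := fun ε hε => by
  have h1 := mem_closedBall_zero_iff.1 hε
  have h2 := mem_ball_zero_iff.1 hz
  show ‖z‖ * ‖ε‖ < 1
  nlinarith [norm_nonneg z, norm_nonneg ε]

theorem analyticOnNhd (M : IsMoebiusKernel α β d₀ d₁ j κ) {z : ℂ} (hz : z ∈ ball (0 : ℂ) 1) :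
    AnalyticOnNhd ℂ (fun ε => moebiusInt α β d₀ d₁ (fun _ => ε) z) (closedBall 0 1) :=
  ((M.differentiableOn_moebiusInt hz).analyticOnNhd (isOpen_param z)).mono
    (closedBall_subset_param hz)

/-- This stands in for a winding number argument. On the circle `q - w = -κ ε N c` with `Re c ≤ 0`,
while `q' = κ N`, so the function `f` below equals `1 / c` there and has real part at most zero. -/
theorem moebiusInt_mem_image (M : IsMoebiusKernel α β d₀ d₁ j κ) {ψ : ℂ → ℂ} (hψ : IsSchur ψ)
    {z : ℂ} (hz : z ∈ ball (0 : ℂ) 1) (hz0 : z ≠ 0) :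
    moebiusInt α β d₀ d₁ ψ z ∈
      (fun ε => moebiusInt α β d₀ d₁ (fun _ => ε) z) '' closedBall 0 1 := by
  by_contra hw
  set w := moebiusInt α β d₀ d₁ ψ z
  set q : ℂ → ℂ := fun ε => moebiusInt α β d₀ d₁ (fun _ => ε) z with hqdef
  have hU := closedBall_subset_param hz
  have hqw : ∀ ε ∈ closedBall (0 : ℂ) 1, q ε - w ≠ 0 := fun ε hε h =>
    hw ⟨ε, hε, sub_eq_zero.1 h⟩
  have hqd := M.differentiableOn_moebiusInt hz
  set f : ℂ → ℂ := fun ε => -(ε * deriv q ε / (q ε - w)) with hf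
  have hfd : ∀ ε ∈ closedBall (0 : ℂ) 1, DifferentiableAt ℂ f ε := by
    intro ε hε
    have hn := (isOpen_param z).mem_nhds (hU hε)
    exact ((differentiableAt_id.mul ((hqd.deriv (isOpen_param z)).differentiableAt hn)).div
      ((hqd.differentiableAt hn).sub_const w) (hqw ε hε)).neg
  have hsphere : ∀ ε ∈ frontier (ball (0 : ℂ) 1), ‖Complex.exp (f ε)‖ ≤ 1 := by
    intro ε hε
    rw [frontier_ball _ one_ne_zero, mem_sphere_zero_iff_norm] at hε
    have hε0 : ε ≠ 0 := norm_ne_zero_iff.1 (by rw [hε]; exact one_ne_zero)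
    obtain ⟨h0, c, hc, hc0, -⟩ := M.exists_moebiusInt_sub hψ.1 hε0 hε.le
      (fun w hw => by rw [hε]; exact hψ.2 w hw) hz hz0
    have hεb : ε ∈ closedBall (0 : ℂ) 1 := mem_closedBall_zero_iff.2 hε.le
    have hd := (M.hasDerivAt_moebiusInt hz (hU hεb)).deriv
    have hκ := M.κ_ne
    have e : f ε = c⁻¹ := by
      have h1 : q ε - w = -(κ * ε * IsMoebiusKernel.normalInt d₀ d₁ j ε z * c) := by
        rw [← hc, neg_sub]
      have hc' : c ≠ 0 := fun h => hqw ε hεb (by rw [h1, h]; simp)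
      have hd' : deriv q ε = _ := hd
      simp only [hf, h1, hd']
      field_simp
    rw [Complex.norm_exp, Real.exp_le_one_iff, e, Complex.inv_re]
    exact div_nonpos_of_nonpos_of_nonneg hc0 (Complex.normSq_nonneg _)
  -- The maximum principle for `exp ∘ f` carries the bound inside, where it is attained at the
  -- centre because `f 0 = 0`.
  have hball : ∀ ε ∈ ball (0 : ℂ) 1, (f ε).re ≤ (f 0).re := by
    intro ε hε
    have := Complex.norm_le_of_forall_mem_frontier_norm_le isBounded_ball
      (f := fun ε => Complex.exp (f ε))
      (DifferentiableOn.diffContOnCl (fun x hx => by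
        rw [closure_ball _ one_ne_zero] at hx
        exact (hfd x hx).cexp.differentiableWithinAt)) hsphere (subset_closure hε)
    rw [Complex.norm_exp, Real.exp_le_one_iff] at this
    simpa [hf] using this
  have hfb : DifferentiableOn ℂ f (ball 0 1) := fun x hx =>
    (hfd x (ball_subset_closedBall hx)).differentiableWithinAt
  have hder := deriv_eq_zero_of_isMaxOn_re isOpen_ball (convex_ball (0 : ℂ) 1).isPreconnected
    hfb zero_mem_unitBall hball
  -- Any nonzero point of the disk would do: `f` vanishes there, hence so does `q'`, against
  -- `normalInt ≠ 0`.
  have hhalf : (1 / 2 : ℂ) ∈ ball (0 : ℂ) 1 := by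
    rw [mem_ball_zero_iff]; norm_num
  have hconst := isOpen_ball.is_const_of_deriv_eq_zero (convex_ball (0 : ℂ) 1).isPreconnected
    hfb (fun x hx => hder x hx) hhalf zero_mem_unitBall
  have hhc := ball_subset_closedBall hhalf
  have hd := (M.hasDerivAt_moebiusInt hz (hU hhc)).deriv
  have h0 := (M.exists_moebiusInt_sub (differentiableOn_const (1 / 2 : ℂ)) (by norm_num)
    (mem_closedBall_zero_iff.1 hhc) (fun _ _ => le_rfl) hz hz0).1
  have := hqw _ hhc
  simp only [hf, zero_mul, zero_div, neg_zero, neg_eq_zero, div_eq_zero_iff, this, or_false,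
    mul_eq_zero] at hconst
  rcases hconst with h | h
  · norm_num at h
  · exact mul_ne_zero M.κ_ne h0 (hd.symm.trans h)

end IsMoebiusKernel

/-! ### The two kernels -/

theorem norm_mul_lt_one {a b : ℂ} (ha : ‖a‖ ≤ 1) (hb : ‖b‖ < 1) : ‖a * b‖ < 1 := by
  rw [norm_mul]; nlinarith [norm_nonneg a, norm_nonneg b]

theorem one_add_ne_zero {x : ℂ} (hx : ‖x‖ < 1) : 1 + x ≠ 0 := fun h => by
  rw [← neg_eq_of_add_eq_zero_right h] at hx; simp at hx

theorem re_div_pos {a b : ℂ} (hb : b ≠ 0) (h : 0 < (a * (starRingEnd ℂ) b).re) :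
    0 < (a / b).re := by
  have hb' := (map_ne_zero (starRingEnd ℂ)).2 hb
  rw [← mul_div_mul_right a b hb', Complex.mul_conj, Complex.div_ofReal_re]
  exact div_pos h (Complex.normSq_pos.2 hb)

theorem isMoebiusKernel_zero {A B : ℂ} (hB : ‖B‖ ≤ 1) (hAB : A ≠ B) :
    IsMoebiusKernel (fun _ => 0) (fun _ => A - B) (fun _ => 1) (fun ζ => B * ζ) 0 (A - B) where
  diff_α := by fun_prop
  diff_β := by fun_prop
  diff_d₀ := by fun_prop
  diff_d₁ := by fun_prop
  κ_ne := sub_ne_zero.2 hAB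
  det ζ := by simp
  d₀_ne _ _ := one_ne_zero
  norm_le ζ _ := by
    rw [norm_mul, norm_one, mul_one]
    exact mul_le_of_le_one_left (norm_nonneg _) hB
  re_pos ζ hζ ε hε := by
    have hx : ‖B * ζ * ε‖ < 1 := by
      rw [mul_comm]
      exact norm_mul_lt_one hε (norm_mul_lt_one hB (mem_ball_zero_iff.1 hζ))
    have h0 := one_add_ne_zero hx
    -- The quantity is the Cayley transform `(1 - x) / (1 + x)` at `x = B ζ ε`, `|x| < 1`.
    have e : ((0 : ℕ) + 1 - 2 * (ζ * (deriv (fun _ : ℂ => (1 : ℂ)) ζ +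
        deriv (fun ζ => B * ζ) ζ * ε) / (1 + B * ζ * ε)) : ℂ) =
        (1 - B * ζ * ε) / (1 + B * ζ * ε) := by
      rw [deriv_const, deriv_const_mul_field, deriv_id'']
      rw [mul_div_assoc', eq_div_iff h0, sub_mul, div_mul_cancel₀ _ h0]
      push_cast
      ring
    rw [e]
    refine re_div_pos h0 ?_
    have h1 : Complex.normSq (B * ζ * ε) < 1 := by
      rw [Complex.normSq_eq_norm_sq]; nlinarith [norm_nonneg (B * ζ * ε)]
    generalize B * ζ * ε = x at *
    rw [Complex.normSq_apply] at h1
    simp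
    linarith

/-- Replacing `Re (g x)` and `Re (conj g * y)` by `-|x|` and `-|y|` in the expansion leaves the
lower bound `(1 - |x||y|)(1 - |x|)(1 - |y|)`. -/
theorem re_pos_of_norm_lt {g x y : ℂ} (hg : ‖g‖ ≤ 1) (hx : ‖x‖ < 1) (hy : ‖y‖ < 1) :
    0 < ((1 - x * y) * (starRingEnd ℂ) (1 + g * x + (starRingEnd ℂ) g * y + x * y)).re := by
  have e : ((1 - x * y) * (starRingEnd ℂ) (1 + g * x + (starRingEnd ℂ) g * y + x * y)).re =
      1 - Complex.normSq x * Complex.normSq y + (g * x).re * (1 - Complex.normSq y) +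
        ((starRingEnd ℂ) g * y).re * (1 - Complex.normSq x) := by
    simp only [Complex.normSq_apply, Complex.mul_re, Complex.mul_im, Complex.add_re,
      Complex.add_im, Complex.sub_re, Complex.sub_im, Complex.one_re, Complex.one_im,
      Complex.conj_re, Complex.conj_im]
    ring
  rw [e, Complex.normSq_eq_norm_sq, Complex.normSq_eq_norm_sq]
  have h1 : -‖x‖ ≤ (g * x).re := by
    have := (abs_le.1 (Complex.abs_re_le_norm (g * x))).1
    rw [norm_mul] at this
    nlinarith [norm_nonneg x]
  have h2 : -‖y‖ ≤ ((starRingEnd ℂ) g * y).re := by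
    have := (abs_le.1 (Complex.abs_re_le_norm ((starRingEnd ℂ) g * y))).1
    rw [norm_mul, RCLike.norm_conj] at this
    nlinarith [norm_nonneg y]
  have h3 := norm_nonneg x
  have h4 := norm_nonneg y
  have h5 : 0 < (1 - ‖x‖ * ‖y‖) * ((1 - ‖x‖) * (1 - ‖y‖)) :=
    mul_pos (by nlinarith) (mul_pos (by linarith) (by linarith))
  nlinarith [mul_le_mul_of_nonneg_right h1 (show 0 ≤ 1 - ‖y‖ ^ 2 by nlinarith),
    mul_le_mul_of_nonneg_right h2 (show 0 ≤ 1 - ‖x‖ ^ 2 by nlinarith)]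

theorem normSq_one_add_sub (g s : ℂ) :
    Complex.normSq (1 + (starRingEnd ℂ) g * s) - Complex.normSq (s + g) =
      (1 - Complex.normSq g) * (1 - Complex.normSq s) := by
  simp only [Complex.normSq_apply, Complex.mul_re, Complex.mul_im, Complex.add_re,
    Complex.add_im, Complex.one_re, Complex.one_im, Complex.conj_re, Complex.conj_im]
  ring

theorem norm_add_le_norm_one_add {g s : ℂ} (hg : ‖g‖ ≤ 1) (hs : ‖s‖ ≤ 1) :
    ‖s + g‖ ≤ ‖1 + (starRingEnd ℂ) g * s‖ := by
  have h := normSq_one_add_sub g s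
  simp only [Complex.normSq_eq_norm_sq] at h
  have : 0 ≤ (1 - ‖g‖ ^ 2) * (1 - ‖s‖ ^ 2) :=
    mul_nonneg (by nlinarith [norm_nonneg g]) (by nlinarith [norm_nonneg s])
  exact (sq_le_sq₀ (norm_nonneg _) (norm_nonneg _)).1 (by linarith)

/-- These coefficients come from putting `φ = σ g (ζ w)` into `(A - B) φ / (1 + B ζ φ)` and clearing
the inner denominator. -/
theorem isMoebiusKernel_one {A B g : ℂ} (hB : ‖B‖ ≤ 1) (hAB : A ≠ B) (hg : ‖g‖ < 1) :
    IsMoebiusKernel (fun _ => (A - B) * g) (fun ζ => (A - B) * ζ) (fun ζ => 1 + B * g * ζ)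
      (fun ζ => ζ * ((starRingEnd ℂ) g + B * ζ)) 1 ((A - B) * (1 - g * (starRingEnd ℂ) g)) where
  diff_α := by fun_prop
  diff_β := by fun_prop
  diff_d₀ := by fun_prop
  diff_d₁ := by fun_prop
  κ_ne := by
    refine mul_ne_zero (sub_ne_zero.2 hAB) (sub_ne_zero.2 fun h => ?_)
    have := congrArg norm h
    rw [norm_one, norm_mul, RCLike.norm_conj] at this
    nlinarith [norm_nonneg g]
  det ζ := by ring
  d₀_ne ζ hζ := one_add_ne_zero (by
    rw [mul_assoc]
    exact norm_mul_lt_one hB (norm_mul_lt_one hg.le (mem_ball_zero_iff.1 hζ)))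
  norm_le ζ hζ := by
    rw [norm_mul]
    refine mul_le_mul_of_nonneg_left ?_ (norm_nonneg _)
    have := norm_add_le_norm_one_add (g := (starRingEnd ℂ) g) (s := B * ζ)
      (by rw [RCLike.norm_conj]; exact hg.le) (norm_mul_lt_one hB (mem_ball_zero_iff.1 hζ)).le
    rw [Complex.conj_conj] at this
    rw [add_comm, show B * g * ζ = g * (B * ζ) by ring]
    exact this
  re_pos ζ hζ ε hε := by
    have hζ' := mem_ball_zero_iff.1 hζ
    have h := re_pos_of_norm_lt hg.le (norm_mul_lt_one hB hζ') (norm_mul_lt_one hε hζ')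
    have hD : 1 + g * (B * ζ) + (starRingEnd ℂ) g * (ε * ζ) + B * ζ * (ε * ζ) ≠ 0 := fun h0 => by
      rw [h0] at h; simp at h
    have h1 := re_div_pos hD h
    have e0 : HasDerivAt (fun ζ : ℂ => 1 + B * g * ζ) (B * g) ζ := by
      simpa using ((hasDerivAt_id ζ).const_mul (B * g)).const_add 1
    have e1 : HasDerivAt (fun ζ : ℂ => ζ * ((starRingEnd ℂ) g + B * ζ))
        ((starRingEnd ℂ) g + 2 * B * ζ) ζ := by
      refine ((hasDerivAt_id ζ).mul (((hasDerivAt_id ζ).const_mul B).const_add _)).congr_deriv ?_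
      simp only [id]; ring
    have e2 : 1 + B * g * ζ + ζ * ((starRingEnd ℂ) g + B * ζ) * ε =
        1 + g * (B * ζ) + (starRingEnd ℂ) g * (ε * ζ) + B * ζ * (ε * ζ) := by ring
    rw [e0.deriv, e1.deriv, e2]
    -- With `x = B ζ` and `y = ε ζ` this is twice the quotient treated in `re_pos_of_norm_lt`.
    have e3 : ((1 : ℕ) + 1 - 2 * (ζ * (B * g + ((starRingEnd ℂ) g + 2 * B * ζ) * ε) /
        (1 + g * (B * ζ) + (starRingEnd ℂ) g * (ε * ζ) + B * ζ * (ε * ζ))) : ℂ) =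
        (2 : ℝ) * ((1 - B * ζ * (ε * ζ)) /
          (1 + g * (B * ζ) + (starRingEnd ℂ) g * (ε * ζ) + B * ζ * (ε * ζ))) := by
      rw [mul_div_assoc', mul_div_assoc', eq_div_iff hD, sub_mul, div_mul_cancel₀ _ hD]
      push_cast
      ring
    rw [e3, Complex.re_ofReal_mul]
    positivity

/-! ### Schur functions and the class `CV` -/

/-- The logarithm of the derivative of the function in `CV A B` with Schur function `φ`. -/
noncomputable def logDerivInt (A B : ℂ) (φ : ℂ → ℂ) (z : ℂ) : ℂ :=
  segInt (fun ζ => (A - B) * φ ζ / (1 + B * ζ * φ ζ)) z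

theorem logDerivInt_congr {A B : ℂ} {φ ψ : ℂ → ℂ} (h : ∀ ζ ∈ ball (0 : ℂ) 1, φ ζ = ψ ζ) {z : ℂ}
    (hz : z ∈ ball (0 : ℂ) 1) : logDerivInt A B φ z = logDerivInt A B ψ z :=
  segInt_congr fun ζ hζ => by simp only [h ζ (closedBall_norm_subset_ball hz hζ)]

theorem logDerivInt_eq_moebiusInt (A B : ℂ) (φ : ℂ → ℂ) (z : ℂ) :
    logDerivInt A B φ z =
      moebiusInt (fun _ => 0) (fun _ => A - B) (fun _ => 1) (fun ζ => B * ζ) φ z := by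
  simp [logDerivInt, moebiusInt, moebius]

theorem K_mul_eq_logDerivInt (A B ε z : ℂ) :
    K A B (ε * z) = logDerivInt A B (fun _ => ε) z := by
  rw [K, segInt_mul_left]
  exact segInt_congr fun ζ _ => by
    rw [mul_div_assoc', mul_comm ε (A - B), mul_assoc B ζ ε, mul_comm ζ ε]

theorem sigma_div_eq (A B g ζ s : ℂ) (hs : 1 + (starRingEnd ℂ) g * s ≠ 0) :
    (A - B) * σ g s / (1 + B * ζ * σ g s) =
      (A - B) * (s + g) / (1 + (starRingEnd ℂ) g * s + B * ζ * (s + g)) := by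
  have e : 1 + B * ζ * σ g s = (1 + (starRingEnd ℂ) g * s + B * ζ * (s + g)) /
      (1 + (starRingEnd ℂ) g * s) := by
    rw [σ, mul_div_assoc', eq_div_iff hs, add_mul, div_mul_cancel₀ _ hs, one_mul]
  rw [e, σ, mul_div_assoc', div_div_div_cancel_right₀ hs]

theorem logDerivInt_sigma {A B g : ℂ} (hg : ‖g‖ < 1) {ψ : ℂ → ℂ} {z : ℂ}
    (hψ : ∀ ζ ∈ closedBall (0 : ℂ) ‖z‖, ‖ζ * ψ ζ‖ ≤ 1) :
    logDerivInt A B (fun ζ => σ g (ζ * ψ ζ)) z =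
      moebiusInt (fun _ => (A - B) * g) (fun ζ => (A - B) * ζ) (fun ζ => 1 + B * g * ζ)
        (fun ζ => ζ * ((starRingEnd ℂ) g + B * ζ)) ψ z := by
  refine segInt_congr fun ζ hζ => ?_
  rw [sigma_div_eq, moebius]
  · congr 1 <;> ring
  · refine one_add_ne_zero ?_
    rw [mul_comm]
    exact norm_mul_lt_one (hψ ζ hζ) (by rwa [RCLike.norm_conj])

theorem IsSchur.norm_mul_lt {φ : ℂ → ℂ} (hφ : IsSchur φ) {B ζ : ℂ} (hB : ‖B‖ ≤ 1)
    (hζ : ζ ∈ ball (0 : ℂ) 1) : ‖B * ζ * φ ζ‖ < 1 := by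
  rw [mul_comm]
  exact norm_mul_lt_one (hφ.2 ζ hζ) (norm_mul_lt_one hB (mem_ball_zero_iff.1 hζ))

theorem IsSchur.id_mul_lt {φ : ℂ → ℂ} (hφ : IsSchur φ) {ζ : ℂ} (hζ : ζ ∈ ball (0 : ℂ) 1) :
    ‖ζ * φ ζ‖ < 1 := by
  simpa using hφ.norm_mul_lt (B := 1) (by simp) hζ

theorem sigma_zero (g : ℂ) : σ g 0 = g := by simp [σ]

theorem isSchur_sigma {g : ℂ} (hg : ‖g‖ < 1) {ψ : ℂ → ℂ} (hψ : IsSchur ψ) :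
    IsSchur fun ζ => σ g (ζ * ψ ζ) := by
  have hne : ∀ ζ ∈ ball (0 : ℂ) 1, 1 + (starRingEnd ℂ) g * (ζ * ψ ζ) ≠ 0 := fun ζ hζ =>
    one_add_ne_zero (norm_mul_lt_one (by rw [RCLike.norm_conj]; exact hg.le) (hψ.id_mul_lt hζ))
  have hd : DifferentiableOn ℂ (fun ζ => ζ * ψ ζ) (ball 0 1) := differentiableOn_id.mul hψ.1
  refine ⟨(hd.add_const g).div ((hd.const_mul _).const_add 1) hne, fun ζ hζ => ?_⟩
  change ‖σ g (ζ * ψ ζ)‖ ≤ 1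
  rw [σ, norm_div, div_le_one (norm_pos_iff.2 (hne ζ hζ))]
  exact norm_add_le_norm_one_add hg.le (hψ.id_mul_lt hζ).le

/-- One step of the Schur algorithm: the disk automorphism taking `φ 0` to `0` is applied to `φ`,
and Schwarz's lemma divides out the resulting zero. -/
theorem IsSchur.exists_eq_sigma {φ : ℂ → ℂ} (hφ : IsSchur φ) (h0 : ‖φ 0‖ < 1) :
    ∃ ψ, IsSchur ψ ∧ ∀ ζ ∈ ball (0 : ℂ) 1, φ ζ = σ (φ 0) (ζ * ψ ζ) := by
  set g := φ 0 with hg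
  have hg' : ‖(starRingEnd ℂ) g‖ < 1 := by rwa [RCLike.norm_conj]
  have hne : ∀ ζ ∈ ball (0 : ℂ) 1, 1 + (starRingEnd ℂ) (-g) * φ ζ ≠ 0 := fun ζ hζ =>
    one_add_ne_zero (by
      rw [mul_comm]; exact norm_mul_lt_one (hφ.2 ζ hζ) (by rwa [map_neg, norm_neg]))
  set u : ℂ → ℂ := fun ζ => (φ ζ + -g) / (1 + (starRingEnd ℂ) (-g) * φ ζ) with hu
  have hud : DifferentiableOn ℂ u (ball 0 1) :=
    (hφ.1.add_const _).div ((hφ.1.const_mul _).const_add 1) hne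
  have hu0 : u 0 = 0 := by simp [hu, hg]
  have hu1 : ∀ ζ ∈ ball (0 : ℂ) 1, ‖u ζ‖ ≤ 1 := fun ζ hζ => by
    rw [norm_div, div_le_one (norm_pos_iff.2 (hne ζ hζ))]
    exact norm_add_le_norm_one_add (by rw [norm_neg]; exact h0.le) (hφ.2 ζ hζ)
  refine ⟨dslope u 0, ⟨(Complex.differentiableOn_dslope (ball_mem_nhds 0 one_pos)).2 hud,
    fun ζ hζ => ?_⟩, fun ζ hζ => ?_⟩
  · have := Complex.norm_dslope_le_div_of_mapsTo_ball (R₂ := 1) hud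
      (fun w hw => by rw [hu0]; exact mem_closedBall_zero_iff.2 (hu1 w hw)) hζ
    simpa using this
  · have h1 := sub_smul_dslope u 0 ζ
    simp only [sub_zero, hu0, smul_eq_mul] at h1
    rw [h1, σ, eq_div_iff (one_add_ne_zero (by
      rw [mul_comm]; exact norm_mul_lt_one (hu1 ζ hζ) hg'))]
    have h2 := hne ζ hζ
    have h3 : u ζ * (1 + (starRingEnd ℂ) (-g) * φ ζ) = φ ζ + -g := div_mul_cancel₀ _ h2
    rw [map_neg] at h3
    linear_combination -h3

theorem IsSchur.eq_of_norm_eq_one {φ : ℂ → ℂ} (hφ : IsSchur φ) (h0 : ‖φ 0‖ = 1) :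
    ∀ ζ ∈ ball (0 : ℂ) 1, φ ζ = φ 0 :=
  Complex.eqOn_of_isPreconnected_of_isMaxOn_norm (convex_ball (0 : ℂ) 1).isPreconnected
    isOpen_ball hφ.1 zero_mem_unitBall fun ζ hζ => by simpa [h0] using hφ.2 ζ hζ

/-! ### Convexity of the set of values -/

/-- The function `|1 - x u|² - |u|² = 1 - 2 Re (x u) - (1 - |x|²)|u|²` is concave in `u`; its
concavity defect is the term `h3`. -/
theorem norm_le_norm_one_sub_of_combo {x u v : ℂ} {a b : ℝ} (hx : ‖x‖ ≤ 1) (ha : 0 ≤ a)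
    (hb : 0 ≤ b) (hab : a + b = 1) (hu : ‖u‖ ≤ ‖1 - x * u‖) (hv : ‖v‖ ≤ ‖1 - x * v‖) :
    ‖a * u + b * v‖ ≤ ‖1 - x * (a * u + b * v)‖ := by
  have hx' : 0 ≤ 1 - Complex.normSq x := by
    rw [Complex.normSq_eq_norm_sq]; nlinarith [norm_nonneg x]
  rw [← sq_le_sq₀ (norm_nonneg _) (norm_nonneg _), ← Complex.normSq_eq_norm_sq,
    ← Complex.normSq_eq_norm_sq] at hu hv ⊢
  have h1 := mul_nonneg ha (sub_nonneg.2 hu)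
  have h2 := mul_nonneg hb (sub_nonneg.2 hv)
  have h3 := mul_nonneg (mul_nonneg ha hb) (mul_nonneg hx' (Complex.normSq_nonneg (u - v)))
  obtain rfl : b = 1 - a := by linarith
  rw [← sub_nonneg]
  refine (add_nonneg (add_nonneg h1 h2) h3).trans_eq ?_
  simp only [Complex.normSq_apply, Complex.mul_re, Complex.mul_im, Complex.add_re,
    Complex.add_im, Complex.sub_re, Complex.sub_im, Complex.one_re, Complex.one_im,
    Complex.ofReal_re, Complex.ofReal_im]
  ring

/-- The transform `u = φ / (1 + B ζ φ)` has inverse `φ = u / (1 - B ζ u)` and turns `|φ| ≤ 1` into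
the convex condition `|u| ≤ |1 - B ζ u|`, so convex combinations are taken on the side of `u`. -/
theorem IsSchur.exists_combo {φ₁ φ₂ : ℂ → ℂ} (h₁ : IsSchur φ₁) (h₂ : IsSchur φ₂) {B : ℂ}
    (hB : ‖B‖ ≤ 1) {a b : ℝ} (ha : 0 ≤ a) (hb : 0 ≤ b) (hab : a + b = 1) :
    ∃ φ, IsSchur φ ∧ φ 0 = a * φ₁ 0 + b * φ₂ 0 ∧ ∀ ζ ∈ ball (0 : ℂ) 1,
      φ ζ / (1 + B * ζ * φ ζ) =
        a * (φ₁ ζ / (1 + B * ζ * φ₁ ζ)) + b * (φ₂ ζ / (1 + B * ζ * φ₂ ζ)) := by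
  set u : ℂ → ℂ := fun ζ =>
    a * (φ₁ ζ / (1 + B * ζ * φ₁ ζ)) + b * (φ₂ ζ / (1 + B * ζ * φ₂ ζ)) with hu
  have single : ∀ {φ : ℂ → ℂ}, IsSchur φ → ∀ ζ ∈ ball (0 : ℂ) 1,
      ‖φ ζ / (1 + B * ζ * φ ζ)‖ ≤ ‖1 - B * ζ * (φ ζ / (1 + B * ζ * φ ζ))‖ := by
    intro φ hφ ζ hζ
    have h0 := one_add_ne_zero (hφ.norm_mul_lt hB hζ)
    have e : 1 - B * ζ * (φ ζ / (1 + B * ζ * φ ζ)) = 1 / (1 + B * ζ * φ ζ) := by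
      rw [mul_div_assoc', eq_div_iff h0, sub_mul, div_mul_cancel₀ _ h0]; ring
    rw [e, norm_div, norm_div, norm_one]
    exact div_le_div_of_nonneg_right (hφ.2 ζ hζ) (norm_nonneg _)
  have hle : ∀ ζ ∈ ball (0 : ℂ) 1, ‖u ζ‖ ≤ ‖1 - B * ζ * u ζ‖ := fun ζ hζ =>
    norm_le_norm_one_sub_of_combo (norm_mul_lt_one hB (mem_ball_zero_iff.1 hζ)).le ha hb hab
      (single h₁ ζ hζ) (single h₂ ζ hζ)
  have hne : ∀ ζ ∈ ball (0 : ℂ) 1, 1 - B * ζ * u ζ ≠ 0 := fun ζ hζ h => by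
    have h1 := hle ζ hζ
    rw [h, norm_zero, norm_le_zero_iff] at h1
    rw [h1] at h; simp at h
  have hBd : DifferentiableOn ℂ (fun ζ : ℂ => B * ζ) (ball 0 1) := by fun_prop
  have hud : DifferentiableOn ℂ u (ball 0 1) :=
    ((h₁.1.div ((hBd.mul h₁.1).const_add 1) fun ζ hζ =>
      one_add_ne_zero (h₁.norm_mul_lt hB hζ)).const_mul _).add
    ((h₂.1.div ((hBd.mul h₂.1).const_add 1) fun ζ hζ =>
      one_add_ne_zero (h₂.norm_mul_lt hB hζ)).const_mul _)
  refine ⟨fun ζ => u ζ / (1 - B * ζ * u ζ), ⟨hud.div ((hBd.mul hud).const_sub 1) hne,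
    fun ζ hζ => ?_⟩, by simp [hu], fun ζ hζ => ?_⟩
  · rw [norm_div, div_le_one (norm_pos_iff.2 (hne ζ hζ))]
    exact hle ζ hζ
  · have h0 := hne ζ hζ
    have e : 1 + B * ζ * (u ζ / (1 - B * ζ * u ζ)) = 1 / (1 - B * ζ * u ζ) := by
      rw [mul_div_assoc', eq_div_iff h0, add_mul, div_mul_cancel₀ _ h0]; ring
    change u ζ / (1 - B * ζ * u ζ) / (1 + B * ζ * (u ζ / (1 - B * ζ * u ζ))) = u ζ
    rw [e, div_div_div_cancel_right₀ h0, div_one]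

theorem IsSchur.differentiableOn_integrand {φ : ℂ → ℂ} (hφ : IsSchur φ) (A : ℂ) {B : ℂ}
    (hB : ‖B‖ ≤ 1) :
    DifferentiableOn ℂ (fun ζ => (A - B) * φ ζ / (1 + B * ζ * φ ζ)) (ball 0 1) := by
  have hBd : DifferentiableOn ℂ (fun ζ : ℂ => B * ζ) (ball 0 1) := by fun_prop
  exact (hφ.1.const_mul _).div ((hBd.mul hφ.1).const_add 1) fun ζ hζ =>
    one_add_ne_zero (hφ.norm_mul_lt hB hζ)

/-- The set `s` serves both regions: `univ` when the second coefficient is free, a singleton when it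
is prescribed. -/
theorem convex_logDerivInt {A B z : ℂ} (hB : ‖B‖ ≤ 1) (hz : z ∈ ball (0 : ℂ) 1) {s : Set ℂ}
    (hs : Convex ℝ s) : Convex ℝ {w | ∃ φ, IsSchur φ ∧ φ 0 ∈ s ∧ w = logDerivInt A B φ z} := by
  rintro _ ⟨φ₁, h₁, h₁s, rfl⟩ _ ⟨φ₂, h₂, h₂s, rfl⟩ a b ha hb hab
  obtain ⟨φ, hφ, h0, h⟩ := h₁.exists_combo h₂ hB ha hb hab
  have hsub := closedBall_norm_subset_ball hz
  refine ⟨φ, hφ, by rw [h0]; simpa using hs h₁s h₂s ha hb hab, ?_⟩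
  rw [Complex.real_smul, Complex.real_smul, logDerivInt, logDerivInt, ← segInt_const_mul,
    ← segInt_const_mul, ← segInt_add
      (g := fun ζ => a * ((A - B) * φ₁ ζ / (1 + B * ζ * φ₁ ζ)))
      (h := fun ζ => b * ((A - B) * φ₂ ζ / (1 + B * ζ * φ₂ ζ)))
      (continuousOn_const.mul ((h₁.differentiableOn_integrand A hB).continuousOn.mono hsub))
      (continuousOn_const.mul ((h₂.differentiableOn_integrand A hB).continuousOn.mono hsub))]
  refine segInt_congr fun ζ hζ => ?_
  simp only [mul_div_assoc, h ζ (hsub hζ)]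
  ring

/-! ### Passage between `CV` and Schur functions -/

theorem hasDerivAt_logDerivInt {φ : ℂ → ℂ} (hφ : IsSchur φ) (A : ℂ) {B : ℂ} (hB : ‖B‖ ≤ 1)
    {z : ℂ} (hz : z ∈ ball (0 : ℂ) 1) :
    HasDerivAt (logDerivInt A B φ) ((A - B) * φ z / (1 + B * z * φ z)) z :=
  hasDerivAt_segInt (hφ.differentiableOn_integrand A hB) hz

theorem coeff_two_eq (f : ℂ → ℂ) : coeff 2 f = deriv (deriv f) 0 / 2 := by
  simp [coeff, iteratedDeriv_succ, iteratedDeriv_zero]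

theorem mem_CV_of_isSchur {φ f : ℂ → ℂ} (hφ : IsSchur φ) {A B : ℂ} (hB : ‖B‖ ≤ 1)
    (hf : ∀ z ∈ ball (0 : ℂ) 1, f z = segInt (fun ζ => Complex.exp (logDerivInt A B φ ζ)) z) :
    f ∈ CV A B ∧ coeff 2 f = (A - B) / 2 * φ 0 ∧
      ∀ z ∈ ball (0 : ℂ) 1, IsLogDerivAt f z (logDerivInt A B φ z) := by
  have hL : DifferentiableOn ℂ (logDerivInt A B φ) (ball 0 1) := fun z hz =>
    (hasDerivAt_logDerivInt hφ A hB hz).differentiableAt.differentiableWithinAt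
  have hf1 : ∀ z ∈ ball (0 : ℂ) 1, HasDerivAt f (Complex.exp (logDerivInt A B φ z)) z :=
    fun z hz => (hasDerivAt_segInt hL.cexp hz).congr_of_eventuallyEq (by
      filter_upwards [isOpen_ball.mem_nhds hz] with w hw using hf w hw)
  have hf2 : ∀ z ∈ ball (0 : ℂ) 1, HasDerivAt (deriv f)
      (Complex.exp (logDerivInt A B φ z) * ((A - B) * φ z / (1 + B * z * φ z))) z :=
    fun z hz => (hasDerivAt_logDerivInt hφ A hB hz).cexp.congr_of_eventuallyEq (by
      filter_upwards [isOpen_ball.mem_nhds hz] with w hw using (hf1 w hw).deriv)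
  have hL0 : logDerivInt A B φ 0 = 0 := segInt_zero_right _
  refine ⟨⟨⟨analyticOnNhd_of_differentiableOn_ball fun z hz =>
    (hf1 z hz).differentiableAt.differentiableWithinAt, ?_, ?_⟩, fun z hz => ?_, ?_⟩, ?_, ?_⟩
  · rw [hf 0 zero_mem_unitBall, segInt_zero_right]
  · rw [(hf1 0 zero_mem_unitBall).deriv, hL0, Complex.exp_zero]
  · rw [(hf1 z hz).deriv]; exact Complex.exp_ne_zero _
  · refine ⟨fun z => z * φ z, analyticOnNhd_of_differentiableOn_ball (differentiableOn_id.mul hφ.1),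
      zero_mul _, fun z hz => mem_ball_zero_iff.2 (hφ.id_mul_lt hz), fun z hz => ?_⟩
    have h0 : 1 + B * (z * φ z) ≠ 0 := by
      rw [← mul_assoc]; exact one_add_ne_zero (hφ.norm_mul_lt hB hz)
    have he := Complex.exp_ne_zero (logDerivInt A B φ z)
    simp only [(hf2 z hz).deriv, (hf1 z hz).deriv, P]
    rw [eq_div_iff h0, mul_div_assoc, mul_div_cancel_left₀ _ he, mul_assoc B, add_mul,
      mul_assoc, div_mul_cancel₀ _ h0]
    ring
  · rw [coeff_two_eq, (hf2 0 zero_mem_unitBall).deriv, hL0]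
    simp; ring
  · exact fun z hz => ⟨_, analyticOnNhd_of_differentiableOn_ball hL, hL0,
      fun ζ hζ => (hf1 ζ hζ).deriv.symm, rfl⟩

/-- The Schur function is `ω(z) / z`, extended over the origin by `dslope` and bounded by Schwarz's
lemma. -/
theorem exists_isSchur_of_mem_CV {A B : ℂ} (hB : ‖B‖ ≤ 1) {f : ℂ → ℂ} (hf : f ∈ CV A B)
    {z w : ℂ} (hz : z ∈ ball (0 : ℂ) 1) (hw : IsLogDerivAt f z w) :
    ∃ φ, IsSchur φ ∧ coeff 2 f = (A - B) / 2 * φ 0 ∧ w = logDerivInt A B φ z ∧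
      ∀ ζ ∈ ball (0 : ℂ) 1, f ζ = segInt (fun ζ => Complex.exp (logDerivInt A B φ ζ)) ζ := by
  obtain ⟨⟨hfa, hf0, hf1⟩, hne, ω, hωa, hω0, hωm, hω⟩ := hf
  obtain ⟨L, hLa, hL0, hLe, rfl⟩ := hw
  have hLd := hLa.differentiableOn
  have hωd := hωa.differentiableOn
  have hfd : ∀ ζ ∈ ball (0 : ℂ) 1, HasDerivAt f (Complex.exp (L ζ)) ζ := fun ζ hζ => by
    rw [hLe ζ hζ]; exact (hfa ζ hζ).differentiableAt.hasDerivAt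
  have hf2 : ∀ ζ ∈ ball (0 : ℂ) 1, deriv (deriv f) ζ = Complex.exp (L ζ) * deriv L ζ :=
    fun ζ hζ => ((hLa ζ hζ).differentiableAt.hasDerivAt.cexp.congr_of_eventuallyEq (by
      filter_upwards [isOpen_ball.mem_nhds hζ] with w hw using (hLe w hw).symm)).deriv
  have hφ : IsSchur (dslope ω 0) := by
    refine ⟨(Complex.differentiableOn_dslope (ball_mem_nhds 0 one_pos)).2 hωd, fun ζ hζ => ?_⟩
    have := Complex.norm_dslope_le_div_of_mapsTo_ball (R₂ := 1) hωd
      (fun w hw => by rw [hω0]; exact ball_subset_closedBall (hωm hw)) hζ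
    simpa using this
  have hωe : ∀ ζ, ω ζ = ζ * dslope ω 0 ζ := fun ζ => by
    have := sub_smul_dslope ω 0 ζ
    simpa [hω0] using this.symm
  have hgd := hφ.differentiableOn_integrand A hB
  have hL' : ∀ ζ ∈ ball (0 : ℂ) 1,
      deriv L ζ = (A - B) * dslope ω 0 ζ / (1 + B * ζ * dslope ω 0 ζ) := by
    -- The subordination carries a factor `ζ` and says nothing about `deriv L` at the origin, so
    -- that value is reached by continuity.
    refine eqOn_ball_of_eqOn_ne_zero (hLd.deriv isOpen_ball).continuousOn hgd.continuousOn
      fun ζ hζ hζ0 => ?_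
    have h1 := hω ζ hζ
    have h0 := one_add_ne_zero (hφ.norm_mul_lt hB hζ)
    simp only [P, hωe ζ, hf2 ζ hζ, ← hLe ζ hζ] at h1
    rw [mul_div_assoc, mul_div_cancel_left₀ _ (Complex.exp_ne_zero _), ← mul_assoc B,
      eq_div_iff h0] at h1
    rw [eq_div_iff h0]
    refine mul_left_cancel₀ hζ0 ?_
    linear_combination h1
  have hLi : ∀ ζ ∈ ball (0 : ℂ) 1, L ζ = logDerivInt A B (dslope ω 0) ζ := fun ζ hζ =>
    eq_segInt_of_hasDerivAt hgd.continuousOn (fun ξ hξ => by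
      rw [← hL' ξ hξ]; exact (hLa ξ hξ).differentiableAt.hasDerivAt) hL0 hζ
  refine ⟨dslope ω 0, hφ, ?_, hLi z hz, fun ζ hζ => ?_⟩
  · rw [coeff_two_eq, hf2 0 zero_mem_unitBall, hL0, hL' 0 zero_mem_unitBall]
    simp; ring
  · rw [eq_segInt_of_hasDerivAt hLd.cexp.continuousOn hfd hf0 hζ]
    exact segInt_congr fun ξ hξ => by rw [hLi ξ (closedBall_norm_subset_ball hζ hξ)]

/-! ### The variability regions -/

theorem V_eq {A B z₀ : ℂ} (hB : ‖B‖ ≤ 1) (hz₀ : z₀ ∈ ball (0 : ℂ) 1) :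
    V A B z₀ = {w | ∃ φ, IsSchur φ ∧ φ 0 ∈ univ ∧ w = logDerivInt A B φ z₀} := by
  ext w
  constructor
  · rintro ⟨f, hf, hw⟩
    obtain ⟨φ, hφ, -, hφw, -⟩ := exists_isSchur_of_mem_CV hB hf hz₀ hw
    exact ⟨φ, hφ, mem_univ _, hφw⟩
  · rintro ⟨φ, hφ, -, rfl⟩
    obtain ⟨h1, -, h2⟩ := mem_CV_of_isSchur hφ (A := A) hB fun _ _ => rfl
    exact ⟨_, h1, h2 z₀ hz₀⟩

theorem half_mul_eq_iff {A B c γ x : ℂ} (hAB : A ≠ B) (hγ : γ = 2 * c / (A - B)) :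
    (A - B) / 2 * x = c ↔ x = γ := by
  have := sub_ne_zero.2 hAB
  rw [hγ, eq_div_iff this]
  constructor <;> intro h
  · linear_combination 2 * h
  · linear_combination h / 2

theorem VCoeff_eq {A B z₀ c γ : ℂ} (hB : ‖B‖ ≤ 1) (hAB : A ≠ B) (hγ : γ = 2 * c / (A - B))
    (hz₀ : z₀ ∈ ball (0 : ℂ) 1) :
    VCoeff A B z₀ c = {w | ∃ φ, IsSchur φ ∧ φ 0 ∈ ({γ} : Set ℂ) ∧ w = logDerivInt A B φ z₀} := by
  ext w
  constructor
  · rintro ⟨f, hf, hc, hw⟩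
    obtain ⟨φ, hφ, hφ0, hφw, -⟩ := exists_isSchur_of_mem_CV hB hf hz₀ hw
    exact ⟨φ, hφ, (half_mul_eq_iff hAB hγ).1 (hφ0.symm.trans hc), hφw⟩
  · rintro ⟨φ, hφ, hφ0, rfl⟩
    obtain ⟨h1, h2, h3⟩ := mem_CV_of_isSchur hφ (A := A) hB fun _ _ => rfl
    exact ⟨_, h1, h2.trans ((half_mul_eq_iff hAB hγ).2 hφ0), h3 z₀ hz₀⟩

theorem image_K_closedBall (A B : ℂ) {z : ℂ} (hz0 : z ≠ 0) :
    K A B '' closedBall 0 ‖z‖ = (fun ε => logDerivInt A B (fun _ => ε) z) '' closedBall 0 1 := by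
  have hz := norm_pos_iff.2 hz0
  ext w
  constructor
  · rintro ⟨u, hu, rfl⟩
    refine ⟨u / z, ?_, ?_⟩
    · rw [mem_closedBall_zero_iff] at hu ⊢
      rw [norm_div]; exact (div_le_one hz).2 hu
    · simp only [← K_mul_eq_logDerivInt, div_mul_cancel₀ _ hz0]
  · rintro ⟨ε, hε, rfl⟩
    refine ⟨ε * z, ?_, K_mul_eq_logDerivInt A B ε z⟩
    rw [mem_closedBall_zero_iff] at hε ⊢
    rw [norm_mul]; exact mul_le_of_le_one_left hz.le hε

theorem V_eq_image_K {A B z₀ : ℂ} (hB : ‖B‖ ≤ 1) (hAB : A ≠ B) (hz₀ : z₀ ∈ ball (0 : ℂ) 1)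
    (hz₀' : z₀ ≠ 0) : V A B z₀ = K A B '' closedBall 0 ‖z₀‖ := by
  rw [V_eq hB hz₀, image_K_closedBall A B hz₀']
  simp only [logDerivInt_eq_moebiusInt]
  apply Subset.antisymm
  · rintro _ ⟨φ, hφ, -, rfl⟩
    exact (isMoebiusKernel_zero hB hAB).moebiusInt_mem_image hφ hz₀ hz₀'
  · rintro _ ⟨ε, hε, rfl⟩
    exact ⟨_, isSchur_const (mem_closedBall_zero_iff.1 hε), mem_univ _, rfl⟩

theorem convex_V {A B z₀ : ℂ} (hB : ‖B‖ ≤ 1) (hz₀ : z₀ ∈ ball (0 : ℂ) 1) :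
    Convex ℝ (V A B z₀) := by
  rw [V_eq hB hz₀]
  exact convex_logDerivInt hB hz₀ convex_univ

theorem exists_ne_zero_subset_closedBall {a b : ℂ} (ha : a ∈ ball (0 : ℂ) 1)
    (hb : b ∈ ball (0 : ℂ) 1) : ∃ z ∈ ball (0 : ℂ) 1, z ≠ 0 ∧ a ∈ closedBall (0 : ℂ) ‖z‖ ∧
      b ∈ closedBall (0 : ℂ) ‖z‖ := by
  rw [mem_ball_zero_iff] at ha hb
  obtain ⟨r, hr, hr1⟩ := exists_between (max_lt ha hb)
  have hr0 : 0 < r := (norm_nonneg a).trans_lt ((le_max_left _ _).trans_lt hr)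
  have hn : ‖(r : ℂ)‖ = r := by rw [Complex.norm_real, Real.norm_of_nonneg hr0.le]
  refine ⟨r, ?_, by exact_mod_cast hr0.ne', ?_, ?_⟩
  · rwa [mem_ball_zero_iff, hn]
  · rw [mem_closedBall_zero_iff, hn]; exact (le_max_left _ _).trans hr.le
  · rw [mem_closedBall_zero_iff, hn]; exact (le_max_right _ _).trans hr.le

/-- Two points of the unit disk lie in one closed disk of radius `|z| < 1`; written as `ε z`, they
fall under injectivity in `ε`. Convexity of the image of `K` is localized in the same way. -/
theorem injOn_K {A B : ℂ} (hB : ‖B‖ ≤ 1) (hAB : A ≠ B) : InjOn (K A B) (ball 0 1) := by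
  intro a ha b hb h
  obtain ⟨z, hz, hz0, haz, hbz⟩ := exists_ne_zero_subset_closedBall ha hb
  have hmem : ∀ u ∈ closedBall (0 : ℂ) ‖z‖, u / z ∈ closedBall (0 : ℂ) 1 := fun u hu => by
    rw [mem_closedBall_zero_iff] at hu ⊢
    rw [norm_div]; exact (div_le_one (norm_pos_iff.2 hz0)).2 hu
  have := (isMoebiusKernel_zero hB hAB).injOn hz hz0 (hmem a haz) (hmem b hbz) (by
    simp only [← logDerivInt_eq_moebiusInt, ← K_mul_eq_logDerivInt, div_mul_cancel₀ _ hz0, h])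
  exact (div_left_inj' hz0).1 this

theorem differentiableOn_K (A : ℂ) {B : ℂ} (hB : ‖B‖ ≤ 1) :
    DifferentiableOn ℂ (K A B) (ball 0 1) := by
  have h : DifferentiableOn ℂ (fun ζ : ℂ => 1 + B * ζ) (ball 0 1) := by fun_prop
  exact differentiableOn_segInt ((differentiableOn_const (A - B)).div h fun ζ hζ =>
    one_add_ne_zero (norm_mul_lt_one hB (mem_ball_zero_iff.1 hζ)))

theorem convexUnivalentOn_K {A B : ℂ} (hB : ‖B‖ ≤ 1) (hAB : A ≠ B) :
    ConvexUnivalentOn (K A B) (ball 0 1) := by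
  refine ⟨analyticOnNhd_of_differentiableOn_ball (differentiableOn_K A hB), injOn_K hB hAB, ?_⟩
  rintro _ ⟨a, ha, rfl⟩ _ ⟨b, hb, rfl⟩ s t hs ht hst
  obtain ⟨z, hz, hz0, haz, hbz⟩ := exists_ne_zero_subset_closedBall ha hb
  have hV := convex_V (A := A) hB hz
  rw [V_eq_image_K hB hAB hz hz0] at hV
  exact image_mono (closedBall_norm_subset_ball hz)
    (hV (mem_image_of_mem _ haz) (mem_image_of_mem _ hbz) hs ht hst)

/-- The curve is the image of the circle of radius `|z|`, and the bounded component is the image of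
the open disk. -/
theorem isClosedJordanDomain_image {g : ℂ → ℂ} {z : ℂ} (hz0 : z ≠ 0)
    (hg : DifferentiableOn ℂ g (ball 0 1)) (hinj : InjOn g (ball 0 1))
    (hz : z ∈ ball (0 : ℂ) 1) : IsClosedJordanDomain (g '' closedBall 0 ‖z‖) := by
  have hsub := closedBall_norm_subset_ball hz
  have hpos := norm_pos_iff.2 hz0
  have hmem : ∀ ε : Circle, (ε : ℂ) * z ∈ sphere (0 : ℂ) ‖z‖ := fun ε => by
    rw [mem_sphere_zero_iff_norm, norm_mul, Circle.norm_coe, one_mul]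
  have hmem' : ∀ ε : Circle, (ε : ℂ) * z ∈ ball (0 : ℂ) 1 := fun ε =>
    hsub (sphere_subset_closedBall (hmem ε))
  have hrange : range (fun ε : Circle => g (ε * z)) = g '' sphere 0 ‖z‖ := by
    apply Subset.antisymm
    · rintro _ ⟨ε, rfl⟩; exact mem_image_of_mem _ (hmem ε)
    · rintro _ ⟨u, hu, rfl⟩
      rw [mem_sphere_zero_iff_norm] at hu
      have hn : ‖u / z‖ = 1 := by rw [norm_div, hu, div_self hpos.ne']
      exact ⟨⟨u / z, mem_sphere_zero_iff_norm.2 hn⟩, congrArg g (div_mul_cancel₀ u hz0)⟩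
  have hunion : g '' closedBall 0 ‖z‖ = g '' sphere 0 ‖z‖ ∪ g '' ball 0 ‖z‖ := by
    rw [← image_union, sphere_union_ball]
  have hdisj : Disjoint (g '' ball 0 ‖z‖) (g '' sphere 0 ‖z‖) := by
    refine disjoint_left.2 ?_
    rintro _ ⟨u, hu, rfl⟩ ⟨v, hv, h⟩
    rw [hinj (hsub (sphere_subset_closedBall hv)) (hsub (ball_subset_closedBall hu)) h] at hv
    exact disjoint_left.1 sphere_disjoint_ball hv hu
  have hcomp : IsCompact (g '' closedBall 0 ‖z‖) :=
    (isCompact_closedBall _ _).image_of_continuousOn (hg.continuousOn.mono hsub)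
  have hsph : IsCompact (g '' sphere 0 ‖z‖) :=
    (isCompact_sphere _ _).image_of_continuousOn
      (hg.continuousOn.mono (sphere_subset_closedBall.trans hsub))
  have h0 : (0 : ℂ) ∈ ball (0 : ℂ) ‖z‖ := mem_ball_self hpos
  have hbs : ball (0 : ℂ) ‖z‖ ⊆ ball 0 1 := ball_subset_closedBall.trans hsub
  have hopen : IsOpen (g '' ball 0 ‖z‖) := by
    rcases (hg.analyticOnNhd isOpen_ball).is_constant_or_isOpen
      (convex_ball (0 : ℂ) 1).isPreconnected with ⟨w, hw⟩ | h
    · exact absurd (hinj zero_mem_unitBall hz ((hw 0 zero_mem_unitBall).trans (hw z hz).symm))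
        hz0.symm
    · exact h _ hbs isOpen_ball
  have hpre : IsPreconnected (g '' ball 0 ‖z‖) :=
    (convex_ball (0 : ℂ) ‖z‖).isPreconnected.image g (hg.continuousOn.mono hbs)
  have hw : g 0 ∈ (g '' sphere 0 ‖z‖)ᶜ := hdisj.subset_compl_right (mem_image_of_mem g h0)
  -- The image of the open disk is connected, and open by the open mapping theorem. Together with
  -- the open complement of the compact image it splits the complement of the curve.
  have hcc : connectedComponentIn (g '' sphere 0 ‖z‖)ᶜ (g 0) = g '' ball 0 ‖z‖ := by
    apply Subset.antisymm
    · have hsubc := connectedComponentIn_subset (g '' sphere 0 ‖z‖)ᶜ (g 0)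
      refine isPreconnected_connectedComponentIn.subset_left_of_subset_union hopen
        hcomp.isClosed.isOpen_compl ?_ ?_ ⟨g 0, mem_connectedComponentIn hw, mem_image_of_mem g h0⟩
      · exact disjoint_compl_right.mono_left (image_mono ball_subset_closedBall)
      · intro x hx
        by_cases hxb : x ∈ g '' ball 0 ‖z‖
        · exact Or.inl hxb
        · refine Or.inr fun hxc => ?_
          rw [hunion] at hxc
          exact hxc.elim (hsubc hx) hxb
    · exact hpre.subset_connectedComponentIn (mem_image_of_mem g h0) hdisj.subset_compl_right
  refine ⟨fun ε => g (ε * z), ?_, ?_, g 0, ?_, ?_, ?_⟩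
  · exact hg.continuousOn.comp_continuous (by fun_prop) hmem'
  · intro a b hab
    exact Circle.ext (mul_right_cancel₀ hz0 (hinj (hmem' a) (hmem' b) hab))
  · rwa [hrange]
  · rw [hrange, hcc]
    exact hcomp.isBounded.subset (image_mono ball_subset_closedBall)
  · rw [hrange, hcc, hunion]

theorem inv_mul_F {ε : ℂ} (hε : ε ≠ 0) (A B z : ℂ) :
    ε⁻¹ * F A B (ε * z) =
      segInt (fun ζ => Complex.exp (logDerivInt A B (fun _ => ε) ζ)) z := by
  rw [F, segInt_mul_left, segInt_const_mul, inv_mul_cancel_left₀ hε]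
  simp only [K_mul_eq_logDerivInt]

/-- Equality in the supporting half-plane at `ε` forces the Schur function of `f` to be the constant
`ε`, and the Schur function determines `f`. -/
theorem mem_CV_and_isLogDerivAt_K_iff {A B : ℂ} (hB : ‖B‖ ≤ 1) (hAB : A ≠ B) {z₀ : ℂ}
    (hz₀ : z₀ ∈ ball (0 : ℂ) 1) (hz₀' : z₀ ≠ 0) {ε : ℂ} (hε : ‖ε‖ = 1) (f : ℂ → ℂ) :
    (f ∈ CV A B ∧ IsLogDerivAt f z₀ (K A B (ε * z₀))) ↔
      ∀ z ∈ ball (0 : ℂ) 1, f z = ε⁻¹ * F A B (ε * z) := by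
  have hε0 : ε ≠ 0 := norm_ne_zero_iff.1 (by rw [hε]; exact one_ne_zero)
  simp only [inv_mul_F hε0, K_mul_eq_logDerivInt]
  constructor
  · rintro ⟨hf, hw⟩ z hz
    obtain ⟨φ, hφ, -, hφw, hφf⟩ := exists_isSchur_of_mem_CV hB hf hz₀ hw
    rw [logDerivInt_eq_moebiusInt, logDerivInt_eq_moebiusInt] at hφw
    have h := (isMoebiusKernel_zero hB hAB).eq_of_moebiusInt_eq hφ.1 hε.le
      (fun w hw => by rw [hε]; exact hφ.2 w hw) hz₀ hz₀' hφw.symm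
    rw [hφf z hz]
    exact segInt_congr fun ζ hζ => by
      rw [logDerivInt_congr h (closedBall_norm_subset_ball hz hζ)]
  · intro hf
    obtain ⟨h1, -, h2⟩ := mem_CV_of_isSchur (isSchur_const hε.le) hB hf
    exact ⟨h1, h2 z₀ hz₀⟩

/-! ### The region with prescribed second coefficient -/

theorem VCoeff_eq_singleton {A B : ℂ} (hB : ‖B‖ ≤ 1) (hAB : A ≠ B) {z₀ : ℂ}
    (hz₀ : z₀ ∈ ball (0 : ℂ) 1) {c γ : ℂ} (hγ : γ = 2 * c / (A - B)) (hγ1 : ‖γ‖ = 1) :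
    VCoeff A B z₀ c = {segInt (fun ζ => ζ⁻¹ * (P A B (γ * ζ) - 1)) z₀} := by
  have e : segInt (fun ζ => ζ⁻¹ * (P A B (γ * ζ) - 1)) z₀ = logDerivInt A B (fun _ => γ) z₀ := by
    refine segInt_congr_of_ne fun ζ hζ hζ0 => ?_
    have h0 := one_add_ne_zero ((isSchur_const hγ1.le).norm_mul_lt hB
      (closedBall_norm_subset_ball hz₀ hζ))
    have h1 : B * (γ * ζ) = B * ζ * γ := by ring
    rw [P, h1, inv_mul_eq_iff_eq_mul₀ hζ0, mul_div_assoc', div_sub_one h0]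
    congr 1; ring
  rw [e, VCoeff_eq hB hAB hγ hz₀]
  apply Subset.antisymm
  · rintro _ ⟨φ, hφ, rfl, rfl⟩
    exact logDerivInt_congr (hφ.eq_of_norm_eq_one hγ1) hz₀
  · rintro _ rfl
    exact ⟨_, isSchur_const hγ1.le, rfl, rfl⟩

theorem Q_eq_logDerivInt (A B γ z ε : ℂ) :
    Q A B γ z ε = logDerivInt A B (fun ζ => σ γ (ζ * ε)) z := by
  simp only [Q, logDerivInt, mul_comm ε]

/-- The condition `|z||ε| < 1` admits `ε` slightly outside the closed unit disk, as analyticity in a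
neighbourhood requires. -/
theorem Q_eq_moebiusInt {A B γ : ℂ} (hγ : ‖γ‖ < 1) {z ε : ℂ} (hε : ‖z‖ * ‖ε‖ < 1) :
    Q A B γ z ε = moebiusInt (fun _ => (A - B) * γ) (fun ζ => (A - B) * ζ)
      (fun ζ => 1 + B * γ * ζ) (fun ζ => ζ * ((starRingEnd ℂ) γ + B * ζ)) (fun _ => ε) z := by
  rw [Q_eq_logDerivInt]
  refine logDerivInt_sigma hγ (ψ := fun _ => ε) fun ζ hζ => ?_
  rw [norm_mul]
  exact (mul_le_mul_of_nonneg_right (mem_closedBall_zero_iff.1 hζ) (norm_nonneg ε)).trans hε.le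

theorem eqOn_Q_moebiusInt (A B : ℂ) {γ : ℂ} (hγ : ‖γ‖ < 1) {z : ℂ} (hz : z ∈ ball (0 : ℂ) 1) :
    EqOn (Q A B γ z) (fun ε => moebiusInt (fun _ => (A - B) * γ) (fun ζ => (A - B) * ζ)
      (fun ζ => 1 + B * γ * ζ) (fun ζ => ζ * ((starRingEnd ℂ) γ + B * ζ)) (fun _ => ε) z)
      (closedBall 0 1) := fun _ hε =>
  Q_eq_moebiusInt hγ (IsMoebiusKernel.closedBall_subset_param hz hε)

theorem logDerivInt_sigma_of_isSchur {A B γ : ℂ} (hγ : ‖γ‖ < 1) {ψ : ℂ → ℂ} (hψ : IsSchur ψ)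
    {z : ℂ} (hz : z ∈ ball (0 : ℂ) 1) :
    logDerivInt A B (fun ζ => σ γ (ζ * ψ ζ)) z =
      moebiusInt (fun _ => (A - B) * γ) (fun ζ => (A - B) * ζ) (fun ζ => 1 + B * γ * ζ)
        (fun ζ => ζ * ((starRingEnd ℂ) γ + B * ζ)) ψ z :=
  logDerivInt_sigma hγ fun _ hζ => (hψ.id_mul_lt (closedBall_norm_subset_ball hz hζ)).le

theorem VCoeff_eq_image_Q {A B : ℂ} (hB : ‖B‖ ≤ 1) (hAB : A ≠ B) {z₀ : ℂ}
    (hz₀ : z₀ ∈ ball (0 : ℂ) 1) (hz₀' : z₀ ≠ 0) {c γ : ℂ} (hγ : γ = 2 * c / (A - B))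
    (hγ1 : ‖γ‖ < 1) : VCoeff A B z₀ c = Q A B γ z₀ '' closedBall 0 1 := by
  rw [VCoeff_eq hB hAB hγ hz₀]
  apply Subset.antisymm
  · rintro _ ⟨φ, hφ, rfl, rfl⟩
    obtain ⟨ψ, hψ, h⟩ := hφ.exists_eq_sigma hγ1
    rw [logDerivInt_congr h hz₀, logDerivInt_sigma_of_isSchur hγ1 hψ hz₀,
      (eqOn_Q_moebiusInt A B hγ1 hz₀).image_eq]
    exact (isMoebiusKernel_one hB hAB hγ1).moebiusInt_mem_image hψ hz₀ hz₀'
  · rintro _ ⟨ε, hε, rfl⟩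
    exact ⟨_, isSchur_sigma hγ1 (isSchur_const (mem_closedBall_zero_iff.1 hε)),
      by simp [sigma_zero], Q_eq_logDerivInt A B γ z₀ ε⟩

theorem convexUnivalentOn_Q {A B : ℂ} (hB : ‖B‖ ≤ 1) (hAB : A ≠ B) {z₀ : ℂ}
    (hz₀ : z₀ ∈ ball (0 : ℂ) 1) (hz₀' : z₀ ≠ 0) {c γ : ℂ} (hγ : γ = 2 * c / (A - B))
    (hγ1 : ‖γ‖ < 1) : ConvexUnivalentOn (Q A B γ z₀) (closedBall 0 1) := by
  have M := isMoebiusKernel_one hB hAB hγ1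
  refine ⟨fun ε hε => (M.analyticOnNhd hz₀ ε hε).congr ?_,
    (M.injOn hz₀ hz₀').congr (eqOn_Q_moebiusInt A B hγ1 hz₀).symm, ?_⟩
  · filter_upwards [(IsMoebiusKernel.isOpen_param z₀).mem_nhds
      (IsMoebiusKernel.closedBall_subset_param hz₀ hε)] with w hw
    exact (Q_eq_moebiusInt hγ1 hw).symm
  · rw [← VCoeff_eq_image_Q hB hAB hz₀ hz₀' hγ hγ1, VCoeff_eq hB hAB hγ hz₀]
    exact convex_logDerivInt hB hz₀ (convex_singleton γ)

/-- The coefficient fixes `φ 0 = γ`, so `φ = σ γ (ζ ψ)` with `ψ` Schur; the equality case of the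
comparison then gives `ψ = ε`. -/
theorem mem_CV_and_isLogDerivAt_Q_iff {A B : ℂ} (hB : ‖B‖ ≤ 1) (hAB : A ≠ B) {z₀ : ℂ}
    (hz₀ : z₀ ∈ ball (0 : ℂ) 1) (hz₀' : z₀ ≠ 0) {c γ : ℂ} (hγ : γ = 2 * c / (A - B))
    (hγ1 : ‖γ‖ < 1) {ε : ℂ} (hε : ‖ε‖ = 1) (f : ℂ → ℂ) :
    (f ∈ CV A B ∧ coeff 2 f = c ∧ IsLogDerivAt f z₀ (Q A B γ z₀ ε)) ↔
      ∀ z ∈ ball (0 : ℂ) 1, f z = segInt (fun ζ => Complex.exp (Q A B γ ζ ε)) z := by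
  constructor
  · rintro ⟨hf, hc, hw⟩ z hz
    obtain ⟨φ, hφ, hφ0, hφw, hφf⟩ := exists_isSchur_of_mem_CV hB hf hz₀ hw
    obtain rfl := (half_mul_eq_iff hAB hγ).1 (hφ0.symm.trans hc)
    obtain ⟨ψ, hψ, h⟩ := hφ.exists_eq_sigma hγ1
    rw [logDerivInt_congr h hz₀, logDerivInt_sigma_of_isSchur hγ1 hψ hz₀,
      eqOn_Q_moebiusInt A B hγ1 hz₀ (mem_closedBall_zero_iff.2 hε.le)] at hφw
    have h' := (isMoebiusKernel_one hB hAB hγ1).eq_of_moebiusInt_eq hψ.1 hε.le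
      (fun w hw => by rw [hε]; exact hψ.2 w hw) hz₀ hz₀' hφw.symm
    rw [hφf z hz]
    refine segInt_congr fun ζ hζ => ?_
    rw [Q_eq_logDerivInt, logDerivInt_congr (fun ξ hξ => by rw [h ξ hξ, h' ξ hξ])
      (closedBall_norm_subset_ball hz hζ)]
  · intro hf
    simp only [Q_eq_logDerivInt] at hf ⊢
    obtain ⟨h1, h2, h3⟩ := mem_CV_of_isSchur (isSchur_sigma hγ1 (isSchur_const hε.le)) hB hf
    exact ⟨h1, h2.trans ((half_mul_eq_iff hAB hγ).2 (by simp [sigma_zero])), h3 z₀ hz₀⟩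

end Janowski

theorem mainTheorem5 (A B : ℂ) (hB : ‖B‖ ≤ 1) (hAB : A ≠ B)
    (z₀ : ℂ) (hz₀ : z₀ ∈ Metric.ball (0 : ℂ) 1) (hz₀' : z₀ ≠ 0)
    (c : ℂ) (hc : ‖c‖ ≤ ‖A - B‖ / 2) (γ₁ : ℂ) (hγ₁ : γ₁ = 2 * c / (A - B)) :
    -- the region without a condition on the second coefficient
    (Convex ℝ (Janowski.V A B z₀) ∧
      Janowski.IsClosedJordanDomain (Janowski.V A B z₀) ∧
      Janowski.V A B z₀ = Janowski.K A B '' Metric.closedBall 0 ‖z₀‖ ∧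
      Janowski.ConvexUnivalentOn (Janowski.K A B) (Metric.ball 0 1) ∧
      ∀ ε : ℂ, ‖ε‖ = 1 → ∀ f : ℂ → ℂ,
        (f ∈ Janowski.CV A B ∧ Janowski.IsLogDerivAt f z₀ (Janowski.K A B (ε * z₀))) ↔
          ∀ z ∈ Metric.ball (0 : ℂ) 1, f z = ε⁻¹ * Janowski.F A B (ε * z)) ∧
    -- the second coefficient is prescribed, and extremal
    (‖γ₁‖ = 1 →
      Janowski.VCoeff A B z₀ c =
        {Janowski.segInt (fun ζ => ζ⁻¹ * (Janowski.P A B (γ₁ * ζ) - 1)) z₀}) ∧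
    -- the second coefficient is prescribed, and not extremal
    (‖γ₁‖ < 1 →
      Janowski.VCoeff A B z₀ c = Janowski.Q A B γ₁ z₀ '' Metric.closedBall 0 1 ∧
      Janowski.ConvexUnivalentOn (Janowski.Q A B γ₁ z₀) (Metric.closedBall 0 1) ∧
      ∀ ε : ℂ, ‖ε‖ = 1 → ∀ f : ℂ → ℂ,
        (f ∈ Janowski.CV A B ∧ Janowski.coeff 2 f = c ∧
            Janowski.IsLogDerivAt f z₀ (Janowski.Q A B γ₁ z₀ ε)) ↔
          ∀ z ∈ Metric.ball (0 : ℂ) 1,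
            f z = Janowski.segInt (fun ζ => Complex.exp (Janowski.Q A B γ₁ ζ ε)) z) := by
  refine ⟨⟨Janowski.convex_V hB hz₀, ?_, Janowski.V_eq_image_K hB hAB hz₀ hz₀',
    Janowski.convexUnivalentOn_K hB hAB, fun ε hε f =>
      Janowski.mem_CV_and_isLogDerivAt_K_iff hB hAB hz₀ hz₀' hε f⟩,
    Janowski.VCoeff_eq_singleton hB hAB hz₀ hγ₁, fun h =>
      ⟨Janowski.VCoeff_eq_image_Q hB hAB hz₀ hz₀' hγ₁ h,
        Janowski.convexUnivalentOn_Q hB hAB hz₀ hz₀' hγ₁ h, fun ε hε f =>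
          Janowski.mem_CV_and_isLogDerivAt_Q_iff hB hAB hz₀ hz₀' hγ₁ h hε f⟩⟩
  rw [Janowski.V_eq_image_K hB hAB hz₀ hz₀']
  exact Janowski.isClosedJordanDomain_image hz₀' (Janowski.differentiableOn_K A hB)
    (Janowski.injOn_K hB hAB) hz₀
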